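/- Let $p$ be an odd prime, $m>1$ an integer, $q=p^m$ and $\mathrm{GF}(q)=\{x_1,\dots,x_q\}$. Let $\mathcal{C}_{\mathcal{O}}$ be the conic code, i.e. the linear code of length $q+1$ over $\mathrm{GF}(q)$ with generator matrix $$\begin{bmatrix} x_1^2 & x_2^2 & \cdots & x_q^2 & 1\\ x_1 & x_2 & \cdots & x_q & 0\\ 1 & 1 & \cdots & 1 & 0\end{bmatrix}.$$ Let $\mathcal{C}=\mathcal{C}_{\mathcal{O}}^{(p)}$ be its $p$-ary subfield code: the code over $\mathrm{GF}(p)$ generated by the rows of the $3m\times(q+1)$ matrix obtained from a generator matrix of $\mathcal{C}_{\mathcal{O}}$ by replacing every entry by the column of its coordinates in a basis of $\mathrm{GF}(q)$ over $\mathrm{GF}(p)$. The following hold for every choice of the generator matrix and of the basis. Put $D=p^{m-1}(p-1)$. An $[n,k,d]$ code is a $k$-dimensional linear code of length $n$ with minimum Hamming distance $d$. In the tables below, multiplicities of rows with equal weights are added, and weights that are not listed do not occur. (1) If $m$ is odd, then $\mathcal{C}$ is a $[p^m+1,\,2m+1,\,D-p^{(m-1)/2}]$ code. With $R=p^{\frac{m-1}{2}}(-1)^{\frac{(p-1)(m+1)}{4}}$,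 its weight distribution is $$\begin{array}{ll} \text{Weight} & \text{Multiplicity}\\ 0 & 1\\ p^m & p-1\\ D & p(p^m-1)+p^m(p^{m-1}-1)\\ D+1 & p^m(p^m-p^{m-1})\\ D-R & \tfrac12 p^m(p^{m-1}-1)(p-1)\\ D-R+1 & \tfrac12 p^{2m-1}(p-1)^2\\ D+R & \tfrac12 p^m(p^{m-1}-1)(p-1)\\ D+R+1 & \tfrac12 p^{2m-1}(p-1)^2 \end{array}$$ (2) If $m$ is even, then $\mathcal{C}$ is a $[p^m+1,\,2m+1,\,D-(p-1)p^{(m-2)/2}]$ code. With $R=p^{\frac{m-2}{2}}(-1)^{\frac{m(p-1)}{4}}$, its weight distribution is $$\begin{array}{ll} \text{Weight} & \text{Multiplicity}\\ 0 & 1\\ p^m & p-1\\ D & p(p^m-1)\\ D+(p-1)R & \tfrac12 p^m(p^{m-1}-1-(p-1)R)\\ D+(p-1)R+1 & \tfrac12 p^m(p-1)(p^{m-1}+R)\\ D-(p-1)R & \tfrac12 p^m(p^{m-1}-1+(p-1)R)\\ D-(p-1)R+1 & \tfrac12 p^m(p-1)(p^{m-1}-R)\\ D-R & \tfrac12 p^m(p-1)(p^{m-1}-1-(p-1)R)\\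 D-R+1 & \tfrac12 p^m(p-1)^2(p^{m-1}+R)\\ D+R & \tfrac12 p^m(p-1)(p^{m-1}-1+(p-1)R)\\ D+R+1 & \tfrac12 p^m(p-1)^2(p^{m-1}-R) \end{array}$$ (3) If $p>3$, then the dual code $\mathcal{C}^{\perp}$ is a $[p^m+1,\,p^m-2m,\,4]$ code which is distance-optimal with respect to the sphere-packing bound: no $[p^m+1,\,p^m-2m,\,5]$ code over $\mathrm{GF}(p)$ exists, and for every $d>4$ the sphere-packing inequality $$p^{\,p^m-2m}\sum_{i=0}^{\lfloor (d-1)/2\rfloor}\binom{p^m+1}{i}(p-1)^i\le p^{\,p^m+1}$$ fails. -/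

import Mathlib

open scoped Matrix

/-- `C` is an `[n, k, d]` code over `K`: a `k`-dimensional subspace of `K ^ n` whose minimum
Hamming distance (between distinct codewords) exists and is equal to `d`. -/
def IsLinearCode {K : Type*} [Field K] [DecidableEq K] (n k d : ℕ)
    (C : Submodule K (Fin n → K)) : Prop :=
  Module.finrank K C = k ∧
    IsLeast {w : ℕ | ∃ u ∈ C, ∃ v ∈ C, u ≠ v ∧ hammingDist u v = w} d

/-- The dual code with respect to the standard inner product. -/
def dualCode {K : Type*} [Field K] {n : ℕ} (C : Submodule K (Fin n → K)) :
    Submodule K (Fin n → K) where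
  carrier := {v | ∀ c ∈ C, c ⬝ᵥ v = 0}
  zero_mem' := fun c _ => dotProduct_zero c
  add_mem' := fun {v w} hv hw c hc => by
    rw [dotProduct_add, hv c hc, hw c hc, add_zero]
  smul_mem' := fun a v hv c hc => by
    rw [dotProduct_smul, hv c hc, smul_zero]

/-- `A_i`, the number of codewords of Hamming weight `i`. -/
noncomputable def weightCount {K : Type*} [Field K] [DecidableEq K] {n : ℕ}
    (C : Submodule K (Fin n → K)) (i : ℕ) : ℕ :=
  {c : Fin n → K | c ∈ C ∧ hammingNorm c = i}.ncard

/-- The weight distribution of `C` is the one listed in the table `T` of pairs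
`(weight, multiplicity)`. Multiplicities of rows with the same weight are added, and a weight
that is not in the table does not occur. -/
def HasWeightTable {K : Type*} [Field K] [DecidableEq K] {n : ℕ}
    (C : Submodule K (Fin n → K)) (T : List (ℤ × ℚ)) : Prop :=
  ∀ i : ℕ, (weightCount C i : ℚ) =
    (T.map fun r => if r.1 = (i : ℤ) then r.2 else 0).sum

/-- `G` is a generator matrix of `C`: its rows form a basis of `C`. -/
def IsGeneratorMatrix {L : Type*} [Field L] {k n : ℕ} (G : Matrix (Fin k) (Fin n) L)
    (C : Submodule L (Fin n → L)) : Prop :=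
  LinearIndependent L G.row ∧ Submodule.span L (Set.range G.row) = C

/-- The `km × n` matrix over `K` obtained from the `k × n` matrix `G` over `L` by replacing each
entry by the column of its coordinates in the basis `b` of `L` over `K`. -/
noncomputable def expandMatrix {K L : Type*} [Field K] [Field L] [Algebra K L] {k m n : ℕ}
    (b : Module.Basis (Fin m) K L) (G : Matrix (Fin k) (Fin n) L) :
    Matrix (Fin k × Fin m) (Fin n) K :=
  Matrix.of fun r j => b.repr (G r.1 j) r.2

/-- The subfield code, built from a basis `b` of `L` over `K` and a generator matrix `G`:
the row space of the expanded matrix. -/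
noncomputable def subfieldCode {K L : Type*} [Field K] [Field L] [Algebra K L] {k m n : ℕ}
    (b : Module.Basis (Fin m) K L) (G : Matrix (Fin k) (Fin n) L) :
    Submodule K (Fin n → K) :=
  Submodule.span K (Set.range (expandMatrix b G).row)

/-- The matrix with columns `(x_j ^ 2, x_j, 1)` for the elements `x_j` of the field `F`, and last
column `(1, 0, 0)`. -/
def conicMatrix {F : Type*} [Field F] {q : ℕ} (x : Fin q ≃ F) :
    Matrix (Fin 3) (Fin (q + 1)) F :=
  ![Fin.snoc (fun j => x j ^ 2) 1, Fin.snoc (fun j => x j) 0, Fin.snoc (fun _ => 1) 0]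

/-- The conic code over `F`, of length `q + 1`. -/
def conicCode {F : Type*} [Field F] {q : ℕ} (x : Fin q ≃ F) : Submodule F (Fin (q + 1) → F) :=
  Submodule.span F (Set.range (conicMatrix x).row)

/-- An `[n, k, d]` code over `K` is distance-optimal: no `[n, k, d + 1]` code over `K` exists. -/
def IsDistanceOptimal {K : Type*} [Field K] [DecidableEq K] (n k d : ℕ)
    (C : Submodule K (Fin n → K)) : Prop :=
  IsLinearCode n k d C ∧ ¬ ∃ C' : Submodule K (Fin n → K), IsLinearCode n k (d + 1) C'

/-- The inequality of the sphere-packing bound for the parameters `[n, k, d]` over a field with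
`q` elements. -/
def SpherePackingBound (q n k d : ℕ) : Prop :=
  q ^ k * ∑ i ∈ Finset.range ((d - 1) / 2 + 1), n.choose i * (q - 1) ^ i ≤ q ^ n

/-- The table for odd `m` (and odd `p`, so that `4` divides `(p - 1) * (m + 1)`). -/
def conicTableOdd (p m : ℕ) : List (ℤ × ℚ) :=
  let D : ℤ := (p : ℤ) ^ (m - 1) * ((p : ℤ) - 1)
  let R : ℤ := (p : ℤ) ^ ((m - 1) / 2) * (-1) ^ ((p - 1) * (m + 1) / 4)
  let P : ℚ := p
  [ (0, 1),
    ((p : ℤ) ^ m, P - 1),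
    (D, P * (P ^ m - 1) + P ^ m * (P ^ (m - 1) - 1)),
    (D + 1, P ^ m * (P ^ m - P ^ (m - 1))),
    (D - R, P ^ m * (P ^ (m - 1) - 1) * (P - 1) / 2),
    (D - R + 1, P ^ (2 * m - 1) * (P - 1) ^ 2 / 2),
    (D + R, P ^ m * (P ^ (m - 1) - 1) * (P - 1) / 2),
    (D + R + 1, P ^ (2 * m - 1) * (P - 1) ^ 2 / 2) ]

/-- The table for even `m` (and odd `p`, so that `4` divides `m * (p - 1)`). Here `R` and `Q` are
the same number `p ^ ((m - 2) / 2) * (-1) ^ (m * (p - 1) / 4)`, as an integer and as a rational;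
recall that `(√-1) ^ ((p - 1) * m / 2) = (-1) ^ (m * (p - 1) / 4)`. -/
def conicTableEven (p m : ℕ) : List (ℤ × ℚ) :=
  let D : ℤ := (p : ℤ) ^ (m - 1) * ((p : ℤ) - 1)
  let R : ℤ := (p : ℤ) ^ ((m - 2) / 2) * (-1) ^ (m * (p - 1) / 4)
  let P : ℚ := p
  let Q : ℚ := P ^ ((m - 2) / 2) * (-1) ^ (m * (p - 1) / 4)
  [ (0, 1),
    ((p : ℤ) ^ m, P - 1),
    (D, P * (P ^ m - 1)),
    (D + ((p : ℤ) - 1) * R, P ^ m * (P ^ (m - 1) - 1 - (P - 1) * Q) / 2),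
    (D + ((p : ℤ) - 1) * R + 1, P ^ m * (P - 1) * (P ^ (m - 1) + Q) / 2),
    (D - ((p : ℤ) - 1) * R, P ^ m * (P ^ (m - 1) - 1 + (P - 1) * Q) / 2),
    (D - ((p : ℤ) - 1) * R + 1, P ^ m * (P - 1) * (P ^ (m - 1) - Q) / 2),
    (D - R, P ^ m * (P - 1) * (P ^ (m - 1) - 1 - (P - 1) * Q) / 2),
    (D - R + 1, P ^ m * (P - 1) ^ 2 * (P ^ (m - 1) + Q) / 2),
    (D + R, P ^ m * (P - 1) * (P ^ (m - 1) - 1 + (P - 1) * Q) / 2),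
    (D + R + 1, P ^ m * (P - 1) ^ 2 * (P ^ (m - 1) - Q) / 2) ]

/-! Write `q = p ^ m` and `Tr` for the trace to `ZMod p`. The subfield code is the trace code of the
conic code (`subfieldCode_eq_map_trace`), whatever the basis and the generator matrix. Its words are
`(Tr (a x² + b x) + c)_x` followed by `Tr a`, and they are parametrised injectively by `(a, b, c)`
in `F × F × ZMod p`; this gives the dimension `2 m + 1`.

The case `a = 0` is linear. For `a ≠ 0`, completing the square reduces the weight to the number of
`x` with `Tr (a x²) = t`. This form has rank `m` over `ZMod p`; diagonalised, it is counted by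
quadratic Gauss sums. For odd `m` the count is known up to a sign that depends on `a`, and the table
is symmetric in that sign (`traceSqCount_odd`). For even `m` the sign matters. It depends on `a`
only through the quadratic character of `F`, and it is fixed at `a = 1` because the discriminant of
the trace form is then a nonsquare (`not_isSquare_prod_trace_mul_self`, `traceSqCount_even`).
Summing over `a` also needs the joint distribution of `χ(a)` and of the condition `Tr a = 0`, which
the same count supplies. The minimum distances are read off the tables.

A word of the dual is orthogonal to the conic code over `F` itself, so interpolation by polynomials
of degree at most two forces weight at least 4. The third finite difference on `0, 1, 2, 3` has
weight 4. Distance 5 is excluded by packing the vectors of weight two alone. -/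

theorem AddChar.map_finset_sum {A M ι : Type*} [AddCommMonoid A] [CommMonoid M] (ψ : AddChar A M)
    (s : Finset ι) (f : ι → A) : ψ (∑ i ∈ s, f i) = ∏ i ∈ s, ψ (f i) := by
  classical
  induction s using Finset.induction_on with
  | empty => simp
  | insert i s hi ih =>
    rw [Finset.sum_insert hi, Finset.prod_insert hi, AddChar.map_add_eq_mul, ih]

/-! ### Gauss sums and diagonal quadratic equations over a finite field. -/

section QuadraticGaussSum

variable {K : Type*} [Field K] [Fintype K] [DecidableEq K]

/-- The complex quadratic Gauss sum of a finite field. -/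
noncomputable def quadraticGaussSum (ψ : AddChar K ℂ) : ℂ :=
  gaussSum ((quadraticChar K).ringHomComp (Int.castRingHom ℂ)) ψ

theorem quadraticChar_ringHomComp_ne_one (hK : ringChar K ≠ 2) :
    (quadraticChar K).ringHomComp (Int.castRingHom ℂ) ≠ 1 := by
  rw [MulChar.ringHomComp_ne_one_iff (RingHom.injective_int _)]
  exact quadraticChar_ne_one hK

theorem quadraticGaussSum_sq (hK : ringChar K ≠ 2) {ψ : AddChar K ℂ} (hψ : ψ.IsPrimitive) :
    quadraticGaussSum ψ ^ 2 = (quadraticChar K (-1) : ℂ) * Fintype.card K :=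
  gaussSum_sq (quadraticChar_ringHomComp_ne_one hK) ((quadraticChar_isQuadratic K).comp _) hψ

theorem quadraticGaussSum_mulShift (ψ : AddChar K ℂ) {a : K} (ha : a ≠ 0) :
    ∑ u : K, (quadraticChar K u : ℂ) * ψ (a * u) = quadraticChar K a * quadraticGaussSum ψ := by
  have h := gaussSum_mulShift_eq ((quadraticChar K).ringHomComp (Int.castRingHom ℂ)) ψ
    (Units.mk0 a ha)
  rw [((quadraticChar_isQuadratic K).comp _).inv] at h
  simpa [gaussSum, quadraticGaussSum, AddChar.mulShift_apply] using h

/-- An element `u` has `1 + χ(u)` square roots, and the constant `1` contributes a complete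
character sum, which is zero. -/
theorem sum_addChar_mul_sq (hK : ringChar K ≠ 2) {ψ : AddChar K ℂ} (hψ : ψ.IsPrimitive) {a : K}
    (ha : a ≠ 0) :
    ∑ x : K, ψ (a * x ^ 2) = quadraticChar K a * quadraticGaussSum ψ := by
  have h1 : ∀ u : K, ∑ x with x ^ 2 = u, ψ (a * x ^ 2)
      = (quadraticChar K u : ℂ) * ψ (a * u) + ψ (u * a) := by
    intro u
    have h2 : ∑ x with x ^ 2 = u, ψ (a * x ^ 2) = ∑ x : K with x ^ 2 = u, ψ (a * u) :=
      Finset.sum_congr rfl fun x hx => by rw [(Finset.mem_filter.1 hx).2]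
    have h3 : (((Finset.univ.filter fun x : K => x ^ 2 = u).card : ℤ) : ℂ)
        = ((quadraticChar K u + 1 : ℤ) : ℂ) := by
      rw [← quadraticChar_card_sqrts hK u]
      congr 3
      ext x
      simp
    push_cast at h3
    rw [h2, Finset.sum_const, nsmul_eq_mul, h3, mul_comm u a]
    ring
  rw [← Finset.sum_fiberwise Finset.univ (fun x : K => x ^ 2), Finset.sum_congr rfl fun u _ => h1 u,
    Finset.sum_add_distrib, quadraticGaussSum_mulShift ψ ha, AddChar.sum_mulShift a hψ]
  simp [ha]

theorem sum_addChar_weightedSumSquares {ι : Type*} [Fintype ι] [DecidableEq ι]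
    (hK : ringChar K ≠ 2) {ψ : AddChar K ℂ} (hψ : ψ.IsPrimitive) {w : ι → K} (hw : ∀ i, w i ≠ 0)
    {y : K} (hy : y ≠ 0) :
    ∑ x : ι → K, ψ (y * ∑ i, w i * x i ^ 2) =
      (quadraticChar K y * quadraticGaussSum ψ) ^ Fintype.card ι * quadraticChar K (∏ i, w i) := by
  have h : ∀ x : ι → K, ψ (y * ∑ i, w i * x i ^ 2) = ∏ i, ψ ((y * w i) * x i ^ 2) := by
    intro x
    rw [Finset.mul_sum, AddChar.map_finset_sum]
    exact Finset.prod_congr rfl fun i _ => by rw [mul_assoc]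
  simp_rw [h]
  have h2 := Finset.prod_univ_sum (fun _ : ι => (Finset.univ : Finset K))
    (fun i x => ψ ((y * w i) * x ^ 2))
  rw [Fintype.piFinset_univ] at h2
  rw [← h2]
  simp_rw [fun i => sum_addChar_mul_sq hK hψ (mul_ne_zero hy (hw i)), map_mul, Int.cast_mul]
  rw [map_prod, Int.cast_prod, ← Finset.card_univ, ← Finset.prod_const, ← Finset.prod_mul_distrib]
  exact Finset.prod_congr rfl fun i _ => by ring

/-- Orthogonality of additive characters detects `f x = t`; the trivial character `y = 0`
contributes the main term. -/
theorem card_mul_card_fiber {X : Type*} [Fintype X] {ψ : AddChar K ℂ} (hψ : ψ.IsPrimitive)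
    (f : X → K) (t : K) :
    (Fintype.card K : ℂ) * (Finset.univ.filter fun x => f x = t).card =
      Fintype.card X + ∑ y ∈ Finset.univ.erase 0, ψ (y * -t) * ∑ x, ψ (y * f x) := by
  have h1 : ∀ x : X, ∑ y : K, ψ (y * (f x - t)) = if f x = t then (Fintype.card K : ℂ) else 0 := by
    intro x
    rw [AddChar.sum_mulShift _ hψ]
    simp [sub_eq_zero]
  have h2 : ∑ x : X, ∑ y : K, ψ (y * (f x - t)) =
      (Fintype.card K : ℂ) * (Finset.univ.filter fun x => f x = t).card := by
    simp_rw [h1]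
    rw [← Finset.sum_filter, Finset.sum_const, nsmul_eq_mul, mul_comm]
  rw [← h2, Finset.sum_comm, ← Finset.add_sum_erase _ _ (Finset.mem_univ (0 : K))]
  congr 1
  · simp
  · refine Finset.sum_congr rfl fun y _ => ?_
    rw [Finset.mul_sum]
    refine Finset.sum_congr rfl fun x _ => ?_
    rw [← AddChar.map_add_eq_mul]
    ring_nf

theorem sum_erase_zero_addChar {ψ : AddChar K ℂ} (hψ : ψ.IsPrimitive) (t : K) :
    ∑ y ∈ Finset.univ.erase 0, ψ (y * t) = if t = 0 then (Fintype.card K : ℂ) - 1 else -1 := by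
  have h := AddChar.sum_mulShift t hψ
  rw [← Finset.add_sum_erase _ _ (Finset.mem_univ (0 : K))] at h
  rw [zero_mul, AddChar.map_zero_eq_one] at h
  rw [← eq_sub_iff_add_eq'] at h
  rw [h]
  split_ifs <;> simp

/-- The number of solutions of a nondegenerate diagonal quadratic equation in an even number of
variables. -/
theorem card_mul_card_weightedSumSquares_even {ι : Type*} [Fintype ι] [DecidableEq ι]
    (hK : ringChar K ≠ 2) {ψ : AddChar K ℂ} (hψ : ψ.IsPrimitive) {w : ι → K} (hw : ∀ i, w i ≠ 0)
    {k : ℕ} (hk : Fintype.card ι = 2 * k) (t : K) :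
    (Fintype.card K : ℤ) * (Finset.univ.filter fun x : ι → K => ∑ i, w i * x i ^ 2 = t).card =
      (Fintype.card K : ℤ) ^ (2 * k) + (if t = 0 then (Fintype.card K : ℤ) - 1 else -1) *
        (quadraticChar K (∏ i, w i) * (quadraticChar K (-1) * Fintype.card K) ^ k) := by
  have h := card_mul_card_fiber hψ (fun x : ι → K => ∑ i, w i * x i ^ 2) t
  have h2 : ∀ y ∈ Finset.univ.erase (0 : K), ψ (y * -t) * ∑ x : ι → K, ψ (y * ∑ i, w i * x i ^ 2)
      = ψ (y * -t) * (quadraticChar K (∏ i, w i) *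
        ((quadraticChar K (-1) : ℂ) * Fintype.card K) ^ k) := by
    intro y hy
    have hy0 := Finset.ne_of_mem_erase hy
    -- In an even number of variables `χ(y)` occurs to an even power, so the inner sum does not
    -- depend on `y`.
    have h3 : (quadraticChar K y : ℂ) ^ 2 = 1 := by exact_mod_cast quadraticChar_sq_one hy0
    rw [sum_addChar_weightedSumSquares hK hψ hw hy0, hk, pow_mul, mul_pow, h3,
      quadraticGaussSum_sq hK hψ]
    ring
  rw [Finset.sum_congr rfl h2, ← Finset.sum_mul, sum_erase_zero_addChar hψ] at h
  simp only [neg_eq_zero, Fintype.card_fun, hk] at h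
  split_ifs at h ⊢ <;> exact_mod_cast h

/-- The number of solutions of a nondegenerate diagonal quadratic equation in an odd number of
variables. -/
theorem card_mul_card_weightedSumSquares_odd {ι : Type*} [Fintype ι] [DecidableEq ι]
    (hK : ringChar K ≠ 2) {ψ : AddChar K ℂ} (hψ : ψ.IsPrimitive) {w : ι → K} (hw : ∀ i, w i ≠ 0)
    {k : ℕ} (hk : Fintype.card ι = 2 * k + 1) (t : K) :
    (Fintype.card K : ℤ) * (Finset.univ.filter fun x : ι → K => ∑ i, w i * x i ^ 2 = t).card =
      (Fintype.card K : ℤ) ^ (2 * k + 1) + quadraticChar K (∏ i, w i) * quadraticChar K (-t) *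
        (quadraticChar K (-1) * Fintype.card K) ^ (k + 1) := by
  have h := card_mul_card_fiber hψ (fun x : ι → K => ∑ i, w i * x i ^ 2) t
  have h2 : ∀ y ∈ Finset.univ.erase (0 : K), ψ (y * -t) * ∑ x : ι → K, ψ (y * ∑ i, w i * x i ^ 2)
      = ((quadraticChar K y : ℂ) * ψ (-t * y)) * (quadraticGaussSum ψ * quadraticChar K (∏ i, w i) *
        ((quadraticChar K (-1) : ℂ) * Fintype.card K) ^ k) := by
    intro y hy
    have hy0 := Finset.ne_of_mem_erase hy
    have h3 : (quadraticChar K y : ℂ) ^ 2 = 1 := by exact_mod_cast quadraticChar_sq_one hy0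
    rw [sum_addChar_weightedSumSquares hK hψ hw hy0, hk, pow_succ, pow_mul, mul_pow, h3,
      quadraticGaussSum_sq hK hψ, mul_comm y]
    ring
  -- One factor `χ(y)` survives here and makes the sum over `y` a second Gauss sum; at `t = 0` it is
  -- the plain sum of `χ`, which vanishes.
  have h3 : ∑ y ∈ Finset.univ.erase (0 : K), (quadraticChar K y : ℂ) * ψ (-t * y)
      = quadraticChar K (-t) * quadraticGaussSum ψ := by
    rw [Finset.sum_erase _ (by simp)]
    rcases eq_or_ne (-t) 0 with h0 | h0
    · have := quadraticChar_sum_zero hK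
      simp only [h0, zero_mul, AddChar.map_zero_eq_one, mul_one, MulChar.map_zero, Int.cast_zero]
      exact_mod_cast this
    · exact quadraticGaussSum_mulShift ψ h0
  rw [Finset.sum_congr rfl h2, ← Finset.sum_mul, h3, Fintype.card_fun, hk] at h
  have h4 : (quadraticChar K (-t) : ℂ) * quadraticGaussSum ψ *
      (quadraticGaussSum ψ * quadraticChar K (∏ i, w i) *
        ((quadraticChar K (-1) : ℂ) * Fintype.card K) ^ k) =
      quadraticChar K (∏ i, w i) * quadraticChar K (-t) *
        ((quadraticChar K (-1) : ℂ) * Fintype.card K) ^ (k + 1) := by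
    rw [pow_succ _ k, ← quadraticGaussSum_sq hK hψ]
    ring
  rw [h4] at h
  exact_mod_cast h

end QuadraticGaussSum

/-! ### The form `Tr (a x y)`: diagonalisation and discriminant. -/

section TraceForm

variable {K F : Type*} [Field K] [Field F] [Algebra K F]

theorem eq_zero_of_trace_mul_mul_eq_zero [Finite K] [Finite F] {a : F} (ha : a ≠ 0) {x : F}
    (hx : ∀ y, Algebra.trace K F (a * x * y) = 0) : x = 0 := by
  have h := (traceForm_nondegenerate K F).1 (a * x) hx
  exact (mul_eq_zero.1 h).resolve_left ha

/-- A basis which is orthogonal for the form `Tr (a * x * y)`. -/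
theorem exists_basis_trace_mul_orthogonal [Finite F] (h2 : (2 : K) ≠ 0) (a : F) :
    ∃ v : Module.Basis (Fin (Module.finrank K F)) K F,
      ∀ i j, i ≠ j → Algebra.trace K F (a * v i * v j) = 0 := by
  let B : LinearMap.BilinForm K F := LinearMap.mk₂ K (fun x y => Algebra.trace K F (a * x * y))
    (fun x x' y => by rw [mul_add, add_mul, map_add])
    (fun c x y => by rw [mul_smul_comm, smul_mul_assoc, map_smul])
    (fun x y y' => by rw [mul_add, map_add])
    (fun c x y => by rw [mul_smul_comm, map_smul])
  have hB : LinearMap.IsSymm B := ⟨fun x y => by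
    change Algebra.trace K F (a * x * y) = Algebra.trace K F (a * y * x)
    rw [mul_right_comm]⟩
  have : Invertible (2 : K) := invertibleOfNonzero h2
  obtain ⟨v, hv⟩ := LinearMap.BilinForm.exists_orthogonal_basis hB
  exact ⟨v, fun i j hij => hv hij⟩

variable {ι : Type*} [Fintype ι]

theorem trace_mul_self_ne_zero_of_orthogonal [Finite K] [Finite F] {a : F} (ha : a ≠ 0)
    {v : Module.Basis ι K F}
    (hv : ∀ i j, i ≠ j → Algebra.trace K F (a * v i * v j) = 0) (i : ι) :
    Algebra.trace K F (a * v i * v i) ≠ 0 := by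
  intro h
  refine v.ne_zero i (eq_zero_of_trace_mul_mul_eq_zero (K := K) ha fun y => ?_)
  rw [← v.sum_repr y, Finset.mul_sum, map_sum]
  refine Finset.sum_eq_zero fun j _ => ?_
  rw [mul_smul_comm, map_smul]
  rcases eq_or_ne i j with rfl | hij
  · rw [h, smul_zero]
  · rw [hv i j hij, smul_zero]

theorem trace_mul_sq_eq_weightedSumSquares {a : F} {v : Module.Basis ι K F}
    (hv : ∀ i j, i ≠ j → Algebra.trace K F (a * v i * v j) = 0) (c : ι → K) :
    Algebra.trace K F (a * (v.equivFun.symm c) ^ 2) =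
      ∑ i, Algebra.trace K F (a * v i * v i) * c i ^ 2 := by
  have h : a * (v.equivFun.symm c) ^ 2 = ∑ i, ∑ j, (c i * c j) • (a * v i * v j) := by
    rw [v.equivFun_symm_apply, sq, Finset.sum_mul_sum, Finset.mul_sum]
    refine Finset.sum_congr rfl fun i _ => ?_
    rw [Finset.mul_sum]
    refine Finset.sum_congr rfl fun j _ => ?_
    simp only [Algebra.smul_def, map_mul]
    ring
  rw [h, map_sum]
  refine Finset.sum_congr rfl fun i _ => ?_
  rw [map_sum, Finset.sum_eq_single i]
  · rw [map_smul, smul_eq_mul]; ring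
  · intro j _ hj
    rw [map_smul, hv i j hj.symm, smul_zero]
  · simp

theorem card_trace_mul_sq_eq [Fintype K] [Fintype F] [DecidableEq ι] [DecidableEq K] {a : F}
    {v : Module.Basis ι K F}
    (hv : ∀ i j, i ≠ j → Algebra.trace K F (a * v i * v j) = 0) (t : K) :
    (Finset.univ.filter fun x : F => Algebra.trace K F (a * x ^ 2) = t).card =
      (Finset.univ.filter fun c : ι → K =>
        ∑ i, Algebra.trace K F (a * v i * v i) * c i ^ 2 = t).card := by
  symm
  refine Finset.card_equiv v.equivFun.symm.toEquiv fun c => ?_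
  simp only [Finset.mem_filter, Finset.mem_univ, true_and]
  rw [← trace_mul_sq_eq_weightedSumSquares hv c]
  rfl

/-- Frobenius permutes the conjugates cyclically: the wrap-around from `m - 1` to `0` is the
identity `x ^ q ^ m = x`. -/
theorem pow_card_pow_finRotate [Finite F] {q m : ℕ} (hF : Nat.card F = q ^ m) (x : F) (i : Fin m) :
    x ^ q ^ (finRotate m i : ℕ) = x ^ q ^ ((i : ℕ) + 1) := by
  cases m with
  | zero => exact i.elim0
  | succ n =>
    rw [coe_finRotate]
    split_ifs with h
    · have := Fintype.ofFinite F
      rw [h, Fin.val_last, ← hF, Nat.card_eq_fintype_card, FiniteField.pow_card, pow_zero, pow_one]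
    · rfl

theorem odd_card_of_two_ne_zero [Fintype K] (h2 : (2 : K) ≠ 0) : Odd (Fintype.card K) := by
  by_contra hcon
  rw [Nat.not_odd_iff_even, Nat.even_iff, ← FiniteField.even_card_iff_char_two] at hcon
  apply h2
  have := ringChar.Nat.cast_ringChar (R := K)
  rw [hcon] at this
  exact_mod_cast this

/-- In even degree the discriminant of an extension of finite fields is not a square. -/
theorem not_isSquare_prod_trace_mul_self [Fintype K] [Finite F] {m : ℕ}
    (hm : Module.finrank K F = m) (hm2 : Even m) (h2K : (2 : K) ≠ 0) {v : Module.Basis (Fin m) K F}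
    (hv : ∀ i j, i ≠ j → Algebra.trace K F (1 * v i * v j) = 0) :
    ¬ IsSquare (∏ i, Algebra.trace K F (1 * v i * v i)) := by
  rintro ⟨c, hc⟩
  have hm0 : 0 < m := hm ▸ Module.finrank_pos
  have hF2 : (2 : F) ≠ 0 := by
    rw [← map_ofNat (algebraMap K F) 2]
    exact (map_ne_zero _).2 h2K
  -- The matrix of conjugates of the basis: `Mᵀ M` is the Gram matrix. If the discriminant is `c²`,
  -- then `det M = ± c` lies in `K` and is fixed by Frobenius. But Frobenius permutes the rows of
  -- `M` by an `m`-cycle, which is odd for even `m`, so it negates `det M`. Hence `det M = 0`,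
  -- against nondegeneracy.
  let M : Matrix (Fin m) (Fin m) F := Matrix.of fun i j => v j ^ (Fintype.card K ^ (i : ℕ))
  have hcard : Nat.card F = Fintype.card K ^ m := by
    rw [Module.natCard_eq_pow_finrank (K := K) (V := F), hm, Nat.card_eq_fintype_card]
  have h1 : Mᵀ * M =
      Matrix.diagonal fun i => algebraMap K F (Algebra.trace K F (1 * v i * v i)) := by
    ext j k
    rw [Matrix.mul_apply, Matrix.diagonal_apply]
    have : ∑ i, Mᵀ j i * M i k = algebraMap K F (Algebra.trace K F (1 * v j * v k)) := by
      rw [FiniteField.algebraMap_trace_eq_sum_pow, hm, Finset.sum_range, Nat.card_eq_fintype_card]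
      refine Finset.sum_congr rfl fun i _ => ?_
      simp only [Matrix.transpose_apply, M, Matrix.of_apply, one_mul, mul_pow]
    rw [this]
    split_ifs with h
    · rw [h]
    · rw [hv j k h, map_zero]
  have h2 : M.det * M.det = algebraMap K F c * algebraMap K F c := by
    rw [← map_mul, ← hc, map_prod, ← Matrix.det_diagonal, ← h1, Matrix.det_mul,
      Matrix.det_transpose]
  have h3 : M.det ^ Fintype.card K = M.det := by
    have hcK : (algebraMap K F c) ^ Fintype.card K = algebraMap K F c := by
      rw [← map_pow, FiniteField.pow_card]
    rcases mul_self_eq_mul_self_iff.1 h2 with h | h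
    · rw [h, hcK]
    · rw [h, (odd_card_of_two_ne_zero h2K).neg_pow, hcK]
  have h4 : M.det ^ Fintype.card K = - M.det := by
    have hfrob : M.det ^ Fintype.card K = (M.map fun x => x ^ Fintype.card K).det :=
      ((FiniteField.frobeniusAlgHom K F) : F →+* F).map_det M
    have hsub : (M.map fun x => x ^ Fintype.card K) = M.submatrix (finRotate m) id := by
      ext i j
      simp only [Matrix.map_apply, Matrix.submatrix_apply, M, Matrix.of_apply, id]
      rw [← pow_mul, ← pow_succ, pow_card_pow_finRotate hcard]
    rw [hfrob, hsub, Matrix.det_permute, sign_finRotate,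
      Odd.neg_one_pow (Nat.Even.sub_odd hm0 hm2 odd_one)]
    simp
  have h5 : M.det = 0 := by
    have : 2 * M.det = 0 := by linear_combination h3.symm.trans h4
    exact (mul_eq_zero.1 this).resolve_left hF2
  rw [h5, zero_mul, ← map_mul, ← hc] at h2
  have h6 := (map_eq_zero (algebraMap K F)).1 h2.symm
  obtain ⟨i, _, hi⟩ := Finset.prod_eq_zero_iff.1 h6
  exact trace_mul_self_ne_zero_of_orthogonal one_ne_zero hv i hi

end TraceForm

theorem ringChar_zmod_ne_two {p : ℕ} (hp : p ≠ 2) : ringChar (ZMod p) ≠ 2 := by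
  rwa [ZMod.ringChar_zmod_n]

theorem two_ne_zero_zmod {p : ℕ} [Fact p.Prime] (hp : p ≠ 2) : (2 : ZMod p) ≠ 0 :=
  Ring.two_ne_zero (ringChar_zmod_ne_two hp)

theorem ringChar_ne_two_of_algebra {p : ℕ} [Fact p.Prime] {F : Type*} [Field F]
    [Algebra (ZMod p) F] (hp : p ≠ 2) : ringChar F ≠ 2 := by
  have h : (algebraMap (ZMod p) F) 2 ≠ 0 := (map_ne_zero _).2 (two_ne_zero_zmod hp)
  rw [map_ofNat] at h
  intro hF
  apply h
  have := ringChar.Nat.cast_ringChar (R := F)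
  rw [hF] at this
  exact_mod_cast this

/-! ### The number of solutions of `Tr (a x²) = t`. -/

section TraceCounts

variable {p : ℕ} [Fact p.Prime] {F : Type*} [Field F] [Fintype F] [Algebra (ZMod p) F]

/-- The number of `x` with `Tr (a * x ^ 2) = t`. -/
noncomputable def traceSqCount (a : F) (t : ZMod p) : ℕ :=
  (Finset.univ.filter fun x : F => Algebra.trace (ZMod p) F (a * x ^ 2) = t).card

theorem quadraticChar_zmod_neg_one (hp : p ≠ 2) :
    quadraticChar (ZMod p) (-1) = (-1) ^ (p / 2) := by
  rw [quadraticChar_neg_one (ringChar_zmod_ne_two hp), ZMod.card,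
    ZMod.χ₄_eq_neg_one_pow ((Fact.out : p.Prime).eq_two_or_odd.resolve_left hp)]

/-- The sign `s` depends on `a` but not on `t`. Its value is not needed: as `t` varies, `χ(t)` takes
both signs equally often. -/
theorem traceSqCount_odd (hp : p ≠ 2) {k : ℕ}
    (hm : Module.finrank (ZMod p) F = 2 * k + 1) {a : F} (ha : a ≠ 0) :
    ∃ s : ℤ, (s = 1 ∨ s = -1) ∧ ∀ t : ZMod p,
      (traceSqCount a t : ℤ) = (p : ℤ) ^ (2 * k) + s * quadraticChar (ZMod p) t * (p : ℤ) ^ k := by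
  obtain ⟨v, hv⟩ := exists_basis_trace_mul_orthogonal (K := ZMod p) (two_ne_zero_zmod hp) a
  have hw := trace_mul_self_ne_zero_of_orthogonal ha hv
  have hp0 : (p : ℤ) ≠ 0 := by exact_mod_cast (Fact.out : p.Prime).ne_zero
  refine ⟨quadraticChar (ZMod p) (∏ i, Algebra.trace (ZMod p) F (a * v i * v i)) *
    (-1) ^ (p / 2) * ((-1) ^ (p / 2)) ^ (k + 1), ?_, fun t => ?_⟩
  · rw [mul_assoc, ← pow_mul, ← pow_add]
    have hw' : ∏ i, Algebra.trace (ZMod p) F (a * v i * v i) ≠ 0 :=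
      Finset.prod_ne_zero_iff.2 fun i _ => hw i
    rcases quadraticChar_dichotomy hw' with h | h <;>
    rcases neg_one_pow_eq_or ℤ (p / 2 + p / 2 * (k + 1)) with h' | h' <;> rw [h, h'] <;> simp
  · have h := card_mul_card_weightedSumSquares_odd (ringChar_zmod_ne_two hp)
      (ZMod.isPrimitive_stdAddChar p) hw (by rw [Fintype.card_fin, hm]) t
    rw [← card_trace_mul_sq_eq hv, ZMod.card, neg_eq_neg_one_mul t, map_mul,
      quadraticChar_zmod_neg_one hp] at h
    apply mul_left_cancel₀ hp0
    rw [traceSqCount, h]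
    ring

theorem traceSqCount_one_even (hp : p ≠ 2) {k : ℕ}
    (hm : Module.finrank (ZMod p) F = 2 * (k + 1)) (t : ZMod p) :
    (traceSqCount (1 : F) t : ℤ) = (p : ℤ) ^ (2 * k + 1) -
        (if t = 0 then (p : ℤ) - 1 else -1) * ((p : ℤ) ^ k * (-1) ^ ((k + 1) * (p / 2))) := by
  obtain ⟨v, hv⟩ := exists_basis_trace_mul_orthogonal (K := ZMod p) (two_ne_zero_zmod hp) (1 : F)
  have hw := trace_mul_self_ne_zero_of_orthogonal one_ne_zero hv
  have hp0 : (p : ℤ) ≠ 0 := by exact_mod_cast (Fact.out : p.Prime).ne_zero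
  -- The nonsquare discriminant is the source of the minus sign in front of the second term.
  have hs := quadraticChar_neg_one_iff_not_isSquare.2 <|
    not_isSquare_prod_trace_mul_self rfl (hm ▸ even_two_mul _) (two_ne_zero_zmod hp) hv
  have h := card_mul_card_weightedSumSquares_even (ringChar_zmod_ne_two hp)
    (ZMod.isPrimitive_stdAddChar p) hw (by rw [Fintype.card_fin, hm]) t
  rw [← card_trace_mul_sq_eq hv, ZMod.card, quadraticChar_zmod_neg_one hp, hs] at h
  apply mul_left_cancel₀ hp0
  rw [traceSqCount, h]
  ring

theorem card_filter_linearMap_eq {f : F →ₗ[ZMod p] ZMod p} (hf : f ≠ 0) {n : ℕ}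
    (hn : Module.finrank (ZMod p) F = n + 1) (t : ZMod p) :
    (Finset.univ.filter fun x : F => f x = t).card = p ^ n := by
  have hsurj : Function.Surjective f := LinearMap.surjective hf
  have hconst : ∀ s : ZMod p, (Finset.univ.filter fun x : F => f x = s).card =
      (Finset.univ.filter fun x : F => f x = t).card := fun s =>
    AddMonoidHom.card_fiber_eq_of_mem_range f.toAddMonoidHom (hsurj s) (hsurj t)
  have hsum := Finset.card_eq_sum_card_fiberwise (f := f) (s := (Finset.univ : Finset F))
    (t := Finset.univ) (fun _ _ => Finset.mem_univ _)
  rw [Finset.sum_congr rfl fun s _ => hconst s, Finset.sum_const, Finset.card_univ,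
    Finset.card_univ, ZMod.card, Module.card_eq_pow_finrank (K := ZMod p), ZMod.card, hn,
    pow_succ', smul_eq_mul] at hsum
  exact (Nat.eq_of_mul_eq_mul_left (Fact.out : p.Prime).pos hsum).symm

theorem trace_ne_zero_zmod : Algebra.trace (ZMod p) F ≠ 0 := Algebra.trace_ne_zero _ _

variable [DecidableEq F]

theorem card_sq_eq (hF : ringChar F ≠ 2) (u : F) :
    ((Finset.univ.filter fun x : F => x ^ 2 = u).card : ℤ) = quadraticChar F u + 1 := by
  rw [← quadraticChar_card_sqrts hF u]
  congr 2
  ext x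
  simp

/-- Sort the `x` by `u = a x²`: there are `1 + χ(u / a)` of them, and `u / a` and `a u` differ by a
square factor. -/
theorem traceSqCount_eq_sum (hp : p ≠ 2) {a : F} (ha : a ≠ 0) (t : ZMod p) :
    (traceSqCount a t : ℤ) = ∑ u : F with Algebra.trace (ZMod p) F u = t,
      (quadraticChar F (a * u) + 1) := by
  rw [traceSqCount, Finset.card_eq_sum_card_fiberwise (f := fun x : F => a * x ^ 2)
    (t := Finset.univ.filter fun u : F => Algebra.trace (ZMod p) F u = t)
    (fun x hx => by simpa using hx), Nat.cast_sum]
  refine Finset.sum_congr rfl fun u hu => ?_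
  have h : quadraticChar F (a * u) = quadraticChar F (u / a) := by
    have h1 : a * u = a ^ 2 * (u / a) := by field_simp
    rw [h1, map_mul, map_pow, quadraticChar_sq_one ha, one_mul]
  rw [h, ← card_sq_eq (ringChar_ne_two_of_algebra hp), Finset.filter_filter]
  congr 2
  ext x
  simp only [Finset.mem_filter, Finset.mem_univ, true_and] at hu ⊢
  rw [eq_div_iff ha, mul_comm (x ^ 2)]
  constructor
  · exact fun h => h.2
  · exact fun h => ⟨h ▸ hu, h⟩

/-- The count depends on `a` only through `χ(a)`, so its value at `a = 1` determines all the others.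
-/
theorem traceSqCount_eq_add_quadraticChar_mul (hp : p ≠ 2) {n : ℕ}
    (hm : Module.finrank (ZMod p) F = n + 1) (t : ZMod p) {a : F} (ha : a ≠ 0) :
    (traceSqCount a t : ℤ) = (p : ℤ) ^ n + quadraticChar F a *
      ∑ u : F with Algebra.trace (ZMod p) F u = t, quadraticChar F u := by
  rw [traceSqCount_eq_sum hp ha, Finset.sum_add_distrib, Finset.sum_const,
    card_filter_linearMap_eq trace_ne_zero_zmod hm, Finset.mul_sum]
  simp only [map_mul]
  ring

/-- In even degree, the number of solutions of `Tr (a * x ^ 2) = t`. -/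
theorem traceSqCount_even (hp : p ≠ 2) {k : ℕ}
    (hm : Module.finrank (ZMod p) F = 2 * (k + 1)) {a : F} (ha : a ≠ 0) (t : ZMod p) :
    (traceSqCount a t : ℤ) = (p : ℤ) ^ (2 * k + 1) - quadraticChar F a *
        (if t = 0 then (p : ℤ) - 1 else -1) * ((p : ℤ) ^ k * (-1) ^ ((k + 1) * (p / 2))) := by
  have hm' : Module.finrank (ZMod p) F = (2 * k + 1) + 1 := by rw [hm]; ring
  have h1 := traceSqCount_one_even hp hm t
  rw [traceSqCount_eq_add_quadraticChar_mul hp hm' t one_ne_zero, map_one, one_mul] at h1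
  rw [traceSqCount_eq_add_quadraticChar_mul hp hm' t ha]
  linear_combination quadraticChar F a * h1

end TraceCounts

/-! ### The subfield code as a trace code. -/

section SubfieldCode

variable {K L : Type*} [Field K] [Field L] [Algebra K L]

theorem exists_eq_trace_mul [FiniteDimensional K L] [Algebra.IsSeparable K L] (f : L →ₗ[K] K) :
    ∃ a : L, ∀ x, f x = Algebra.trace K L (a * x) := by
  obtain ⟨a, ha⟩ := (LinearMap.BilinForm.toDual (Algebra.traceForm K L)
    (traceForm_nondegenerate K L)).surjective f
  refine ⟨a, fun x => ?_⟩
  rw [← ha, LinearMap.BilinForm.toDual_def, Algebra.traceForm_apply]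

/-- The subfield code is the trace code. -/
theorem subfieldCode_eq_map_trace [FiniteDimensional K L] [Algebra.IsSeparable K L] {k m n : ℕ}
    (b : Module.Basis (Fin m) K L) {G : Matrix (Fin k) (Fin n) L} {C : Submodule L (Fin n → L)}
    (hG : IsGeneratorMatrix G C) :
    subfieldCode b G =
      (C.restrictScalars K).map ((Algebra.trace K L).compLeft (Fin n)) := by
  apply le_antisymm
  · refine Submodule.span_le.2 ?_
    rintro _ ⟨⟨i, l⟩, rfl⟩
    obtain ⟨a, ha⟩ := exists_eq_trace_mul (b.coord l)
    refine ⟨a • G i, ?_, ?_⟩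
    · exact C.smul_mem a (hG.2 ▸ Submodule.subset_span ⟨i, rfl⟩)
    · ext j
      exact (ha (G i j)).symm
  · rintro _ ⟨w, hw, rfl⟩
    have hw' : w ∈ Submodule.span L (Set.range G.row) := hG.2 ▸ hw
    obtain ⟨c, rfl⟩ := Submodule.mem_span_range_iff_exists_fun L |>.1 hw'
    -- Expanding the entry `y = G i j` in the basis gives `Tr (c y) = ∑ Tr (c b_l) y_l`, a
    -- combination of the expanded rows.
    have h : (Algebra.trace K L).compLeft (Fin n) (∑ i, c i • G.row i) =
        ∑ i, ∑ l, Algebra.trace K L (c i * b l) • (expandMatrix b G).row (i, l) := by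
      ext j
      simp only [LinearMap.compLeft_apply, Function.comp_apply, Finset.sum_apply, Pi.smul_apply,
        smul_eq_mul, map_sum]
      refine Finset.sum_congr rfl fun i _ => ?_
      conv_lhs => rw [Matrix.row_apply, ← b.sum_repr (G i j), Finset.mul_sum, map_sum]
      refine Finset.sum_congr rfl fun l _ => ?_
      rw [mul_smul_comm, map_smul, smul_eq_mul, mul_comm]
      rfl
    rw [h]
    exact Submodule.sum_mem _ fun i _ => Submodule.sum_mem _ fun l _ =>
      Submodule.smul_mem _ _ (Submodule.subset_span ⟨(i, l), rfl⟩)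

theorem mem_conicCode_iff {q : ℕ} (x : Fin q ≃ L) (w : Fin (q + 1) → L) :
    w ∈ conicCode x ↔
      ∃ a b c : L, w = Fin.snoc (fun j => a * x j ^ 2 + b * x j + c) a := by
  have h : ∀ d : Fin 3 → L, ∑ i, d i • (conicMatrix x).row i =
      Fin.snoc (fun j => d 0 * x j ^ 2 + d 1 * x j + d 2) (d 0) := by
    intro d
    ext j
    rw [Fin.sum_univ_three]
    refine Fin.lastCases ?_ (fun j => ?_) j <;> simp [conicMatrix, Matrix.row]
  rw [conicCode, Submodule.mem_span_range_iff_exists_fun]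
  simp_rw [h]
  constructor
  · rintro ⟨d, rfl⟩
    exact ⟨d 0, d 1, d 2, rfl⟩
  · rintro ⟨a, b, c, rfl⟩
    exact ⟨![a, b, c], rfl⟩

/-- The codeword of the trace code of the conic code attached to `(a, b, c)`. -/
noncomputable def conicTraceMap (K : Type*) {L : Type*} [Field K] [Field L] [Algebra K L] {q : ℕ}
    (x : Fin q ≃ L) : L × L × K →ₗ[K] (Fin (q + 1) → K) where
  toFun z := Fin.snoc (fun j => Algebra.trace K L (z.1 * x j ^ 2 + z.2.1 * x j) + z.2.2)
    (Algebra.trace K L z.1)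
  map_add' z z' := by
    ext j
    refine Fin.lastCases ?_ (fun j => ?_) j
    · simp
    · simp [add_mul]; ring
  map_smul' r z := by
    ext j
    refine Fin.lastCases ?_ (fun j => ?_) j
    · simp
    · simp [mul_add]

theorem conicTraceMap_castSucc {q : ℕ} (x : Fin q ≃ L) (z : L × L × K) (j : Fin q) :
    conicTraceMap K x z j.castSucc =
      Algebra.trace K L (z.1 * x j ^ 2 + z.2.1 * x j) + z.2.2 := by
  simp [conicTraceMap]

theorem conicTraceMap_last {q : ℕ} (x : Fin q ≃ L) (z : L × L × K) :
    conicTraceMap K x z (Fin.last q) = Algebra.trace K L z.1 := by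
  simp [conicTraceMap]

/-- The constant term of the polynomial enters only through its trace, and the trace is onto; hence
the last parameter lives in `K`. -/
theorem subfieldCode_conic_eq_range [FiniteDimensional K L] [Algebra.IsSeparable K L] {m q : ℕ}
    (x : Fin q ≃ L) (b : Module.Basis (Fin m) K L) {k : ℕ} {G : Matrix (Fin k) (Fin (q + 1)) L}
    (hG : IsGeneratorMatrix G (conicCode x)) :
    subfieldCode b G = LinearMap.range (conicTraceMap K x) := by
  rw [subfieldCode_eq_map_trace b hG]
  have key : ∀ a b c : L, (Algebra.trace K L).compLeft (Fin (q + 1))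
      (Fin.snoc (fun j => a * x j ^ 2 + b * x j + c) a) =
        conicTraceMap K x (a, b, Algebra.trace K L c) := by
    intro a b c
    ext j
    refine Fin.lastCases ?_ (fun j => ?_) j
    · simp [conicTraceMap_last]
    · simp [conicTraceMap_castSucc]
  ext w
  constructor
  · rintro ⟨u, hu, rfl⟩
    obtain ⟨a, b, c, rfl⟩ := (mem_conicCode_iff x u).1 hu
    exact ⟨_, (key a b c).symm⟩
  · rintro ⟨⟨a, b, c⟩, rfl⟩
    obtain ⟨c, rfl⟩ := Algebra.trace_surjective K L c
    exact ⟨_, (mem_conicCode_iff x _).2 ⟨a, b, c, rfl⟩, key a b c⟩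

/-- Adding the values at `y` and `-y` isolates the quadratic part; polarising that part between `y`
and `1` then kills `a`. -/
theorem conicTraceMap_injective [FiniteDimensional K L] [Algebra.IsSeparable K L] {q : ℕ}
    (x : Fin q ≃ L) (h2 : (2 : K) ≠ 0) : Function.Injective (conicTraceMap K x) := by
  rw [← LinearMap.ker_eq_bot, LinearMap.ker_eq_bot']
  rintro ⟨a, b, c⟩ h
  have hx : ∀ y : L, Algebra.trace K L (a * y ^ 2 + b * y) + c = 0 := by
    intro y
    have := congrFun h (x.symm y).castSucc
    rw [conicTraceMap_castSucc] at this
    simpa using this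
  have hc : c = 0 := by simpa using hx 0
  subst hc
  have ha : ∀ y : L, Algebra.trace K L (a * y ^ 2) = 0 := by
    intro y
    have h3 := congrArg₂ (· + ·) (hx y) (hx (-y))
    have h4 : (2 : K) * Algebra.trace K L (a * y ^ 2) = 0 := by
      simp only [map_add, mul_neg, map_neg, neg_sq] at h3
      linear_combination h3
    exact (mul_eq_zero.1 h4).resolve_left h2
  have hb : b = 0 := (traceForm_nondegenerate K L).1 b fun y => by
    have := hx y
    rw [map_add, ha, zero_add, add_zero] at this
    exact this
  have ha0 : a = 0 := (traceForm_nondegenerate K L).1 a fun y => by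
    have h3 := ha (y + 1)
    have h4 : a * (y + 1) ^ 2 = a * y ^ 2 + a * 1 ^ 2 + (a * y + a * y) := by ring
    rw [h4, map_add, map_add, ha, ha, map_add, zero_add, zero_add, ← two_mul] at h3
    exact (mul_eq_zero.1 h3).resolve_left h2
  rw [ha0, hb]
  rfl

end SubfieldCode

/-! ### Weights as numbers of zeros. -/

section Weight

variable {K : Type*} [Field K] [DecidableEq K]

theorem hammingNorm_eq_add_last {n : ℕ} (c : Fin (n + 1) → K) :
    hammingNorm c = hammingNorm (fun j : Fin n => c j.castSucc) +
      if c (Fin.last n) = 0 then 0 else 1 := by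
  simp only [hammingNorm, Finset.card_filter]
  rw [Fin.sum_univ_castSucc]
  congr 1
  simp only [ne_eq, ite_not]

theorem hammingNorm_add_card_eq_zero {n : ℕ} (c : Fin n → K) :
    hammingNorm c + (Finset.univ.filter fun j => c j = 0).card = n := by
  have := Finset.card_filter_add_card_filter_not (s := (Finset.univ : Finset (Fin n)))
    (fun j => c j ≠ 0)
  simpa [hammingNorm] using this

/-- The weight of the codeword attached to `z`. -/
theorem hammingNorm_conicTraceMap {L : Type*} [Field L] [Fintype L] [Algebra K L] {q : ℕ}
    (x : Fin q ≃ L) (z : L × L × K) :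
    (hammingNorm (conicTraceMap K x z) : ℤ) = q -
      (Finset.univ.filter fun y : L => Algebra.trace K L (z.1 * y ^ 2 + z.2.1 * y) + z.2.2 = 0).card
        + if Algebra.trace K L z.1 = 0 then 0 else 1 := by
  rw [hammingNorm_eq_add_last, conicTraceMap_last]
  have h := hammingNorm_add_card_eq_zero fun j : Fin q => conicTraceMap K x z j.castSucc
  have h2 : (Finset.univ.filter fun j : Fin q => conicTraceMap K x z j.castSucc = 0).card =
      (Finset.univ.filter fun y : L =>
        Algebra.trace K L (z.1 * y ^ 2 + z.2.1 * y) + z.2.2 = 0).card := by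
    refine Finset.card_equiv x fun j => ?_
    simp [conicTraceMap_castSucc]
  rw [h2] at h
  push_cast
  omega

end Weight

/-- On nonzero `t` any function of `χ(t) = ±1` is affine in `χ(t)`, and `χ` sums to zero. -/
theorem sum_comp_quadraticChar {K : Type*} [Field K] [Fintype K] [DecidableEq K]
    (hK : ringChar K ≠ 2) (h : ℤ → ℚ) :
    ∑ t : K, h (quadraticChar K t) = h 0 + ((Fintype.card K : ℚ) - 1) / 2 * (h 1 + h (-1)) := by
  rw [← Finset.add_sum_erase _ _ (Finset.mem_univ (0 : K)), MulChar.map_zero]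
  congr 1
  have h1 : ∀ t ∈ Finset.univ.erase (0 : K), h (quadraticChar K t) =
      (h 1 + h (-1)) / 2 + (quadraticChar K t : ℚ) * ((h 1 - h (-1)) / 2) := by
    intro t ht
    rcases quadraticChar_dichotomy (Finset.ne_of_mem_erase ht) with h2 | h2 <;> rw [h2] <;>
      push_cast <;> ring
  have h0 : ∑ t ∈ Finset.univ.erase (0 : K), (quadraticChar K t : ℚ) = 0 := by
    rw [Finset.sum_erase _ (by simp)]
    exact_mod_cast quadraticChar_sum_zero hK
  rw [Finset.sum_congr rfl h1, Finset.sum_add_distrib, ← Finset.sum_mul, h0, Finset.sum_const,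
    Finset.card_erase_of_mem (Finset.mem_univ _), Finset.card_univ, nsmul_eq_mul,
    Nat.cast_sub Fintype.card_pos, Nat.cast_one]
  ring

/-! ### Sums of a test function over the weights of all codewords. -/

section ConicWeight

variable {p : ℕ} [Fact p.Prime] {F : Type*} [Field F] [Fintype F] [Algebra (ZMod p) F]

/-- The weight of the codeword attached to `(a, b, c)`. -/
noncomputable def conicWeight (a b : F) (c : ZMod p) : ℤ :=
  Fintype.card F -
    (Finset.univ.filter fun y : F => Algebra.trace (ZMod p) F (a * y ^ 2 + b * y) + c = 0).card +
      if Algebra.trace (ZMod p) F a = 0 then 0 else 1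

theorem card_eq_pow_of_finrank {m : ℕ} (hm : Module.finrank (ZMod p) F = m) :
    Fintype.card F = p ^ m := by
  rw [Module.card_eq_pow_finrank (K := ZMod p), ZMod.card, hm]

theorem conicWeight_zero_zero_zero : conicWeight (0 : F) 0 (0 : ZMod p) = 0 := by
  simp [conicWeight]

theorem conicWeight_zero_zero {c : ZMod p} (hc : c ≠ 0) :
    conicWeight (0 : F) 0 c = Fintype.card F := by
  simp [conicWeight, hc]

theorem conicWeight_zero {n : ℕ} (hm : Module.finrank (ZMod p) F = n + 1) {b : F} (hb : b ≠ 0)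
    (c : ZMod p) : conicWeight (0 : F) b c = (p : ℤ) ^ n * ((p : ℤ) - 1) := by
  have hf : (Algebra.trace (ZMod p) F) ∘ₗ (LinearMap.mulLeft (ZMod p) b) ≠ 0 := by
    intro h
    exact hb ((traceForm_nondegenerate (ZMod p) F).1 b fun y => LinearMap.congr_fun h y)
  have h := card_filter_linearMap_eq (p := p) hf hm (-c)
  have h2 : (Finset.univ.filter fun y : F =>
      Algebra.trace (ZMod p) F (0 * y ^ 2 + b * y) + c = 0).card = p ^ n := by
    rw [← h]
    congr 1
    ext y
    simp [eq_neg_iff_add_eq_zero]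
  rw [conicWeight, h2, card_eq_pow_of_finrank hm, map_zero, if_pos rfl]
  push_cast
  ring

/-- Completing the square: translation by `b / (2 a)` removes the linear term. -/
theorem conicWeight_of_ne_zero (hp : p ≠ 2) {a : F} (ha : a ≠ 0) (b : F) (c : ZMod p) :
    conicWeight a b c = Fintype.card F -
      traceSqCount a (Algebra.trace (ZMod p) F (b ^ 2 / (4 * a)) - c) +
        if Algebra.trace (ZMod p) F a = 0 then 0 else 1 := by
  have h2 : (2 : F) ≠ 0 := Ring.two_ne_zero (ringChar_ne_two_of_algebra hp)
  rw [conicWeight, traceSqCount]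
  congr 3
  refine Finset.card_equiv (Equiv.addRight (b / (2 * a))) fun y => ?_
  have h4 : a * (y + b / (2 * a)) ^ 2 = (a * y ^ 2 + b * y) + b ^ 2 / (4 * a) := by
    have : (4 : F) = 2 * 2 := by norm_num
    rw [this]
    field_simp
    ring
  simp only [Finset.mem_filter, Finset.mem_univ, true_and, Equiv.coe_addRight]
  rw [h4, map_add _ _ (b ^ 2 / (4 * a))]
  constructor
  · intro h; linear_combination h
  · intro h; linear_combination h

variable [DecidableEq F]

theorem sum_erase_zero_trace_eq {n : ℕ} (hm : Module.finrank (ZMod p) F = n + 1) (g : ℤ → ℚ) :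
    ∑ a ∈ Finset.univ.erase (0 : F), g (if Algebra.trace (ZMod p) F a = 0 then 0 else 1) =
      ((p : ℚ) ^ n - 1) * g 0 + ((p : ℚ) ^ (n + 1) - (p : ℚ) ^ n) * g 1 := by
  have h0 := card_filter_linearMap_eq (trace_ne_zero_zmod (p := p) (F := F)) hm 0
  have h1 := Finset.add_sum_erase Finset.univ
    (fun a : F => g (if Algebra.trace (ZMod p) F a = 0 then 0 else 1)) (Finset.mem_univ (0 : F))
  have h2 : ∀ a : F, g (if Algebra.trace (ZMod p) F a = 0 then 0 else 1) =
      (if Algebra.trace (ZMod p) F a = 0 then g 0 - g 1 else 0) + g 1 := by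
    intro a
    split_ifs <;> ring
  have h3 : ∑ a : F, g (if Algebra.trace (ZMod p) F a = 0 then 0 else 1) =
      (p : ℚ) ^ n * (g 0 - g 1) + (p : ℚ) ^ (n + 1) * g 1 := by
    simp_rw [h2]
    rw [Finset.sum_add_distrib, ← Finset.sum_filter, Finset.sum_const, h0, Finset.sum_const,
      Finset.card_univ, card_eq_pow_of_finrank hm]
    simp only [nsmul_eq_mul]
    push_cast
    ring
  rw [h3] at h1
  simp only [map_zero, if_true] at h1
  linear_combination h1

theorem sum_erase_zero_quadraticChar_trace (hp : p ≠ 2) {n : ℕ}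
    (hm : Module.finrank (ZMod p) F = n + 1) (h : ℤ → ℤ → ℚ) {E : ℚ}
    (hE : ∑ u : F with Algebra.trace (ZMod p) F u = 0, (quadraticChar F u : ℚ) = E) :
    ∑ a ∈ Finset.univ.erase (0 : F),
        h (quadraticChar F a) (if Algebra.trace (ZMod p) F a = 0 then 0 else 1) =
      ((p : ℚ) ^ n - 1 + E) / 2 * h 1 0 + ((p : ℚ) ^ n - 1 - E) / 2 * h (-1) 0 +
      ((p : ℚ) ^ (n + 1) - (p : ℚ) ^ n - E) / 2 * h 1 1 +
      ((p : ℚ) ^ (n + 1) - (p : ℚ) ^ n + E) / 2 * h (-1) 1 := by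
  -- Interpolation on the four pairs (`χ(a) = ±1`, indicator `0` or `1`); only the mixed term
  -- involves `E`.
  have h1 : ∀ a ∈ Finset.univ.erase (0 : F),
      h (quadraticChar F a) (if Algebra.trace (ZMod p) F a = 0 then 0 else 1) =
      (fun d => (h 1 d + h (-1) d) / 2) (if Algebra.trace (ZMod p) F a = 0 then 0 else 1) +
      ((quadraticChar F a : ℚ) * ((h 1 1 - h (-1) 1) / 2) +
      (if Algebra.trace (ZMod p) F a = 0 then (quadraticChar F a : ℚ) else 0) *
        ((h 1 0 - h (-1) 0 - h 1 1 + h (-1) 1) / 2)) := by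
    intro a ha
    rcases quadraticChar_dichotomy (Finset.ne_of_mem_erase ha) with h2 | h2 <;> rw [h2] <;>
      split_ifs <;> push_cast <;> ring
  have h0 : ∑ t ∈ Finset.univ.erase (0 : F), (quadraticChar F t : ℚ) = 0 := by
    rw [Finset.sum_erase _ (by simp)]
    exact_mod_cast quadraticChar_sum_zero (ringChar_ne_two_of_algebra (p := p) (F := F) hp)
  have h3 : ∑ a ∈ Finset.univ.erase (0 : F),
      (if Algebra.trace (ZMod p) F a = 0 then (quadraticChar F a : ℚ) else 0) = E := by
    rw [Finset.sum_erase _ (by simp), ← Finset.sum_filter, hE]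
  rw [Finset.sum_congr rfl h1, Finset.sum_add_distrib,
    sum_erase_zero_trace_eq hm fun d => (h 1 d + h (-1) d) / 2, Finset.sum_add_distrib,
    ← Finset.sum_mul, ← Finset.sum_mul, h0, h3]
  ring

/-- The arbitrary `f` encodes the whole weight distribution. For fixed `a ≠ 0` and `b`, the shifted
value `t = Tr (b² / 4a) - c` runs once through `ZMod p`, so every `b` contributes the same sum. -/
theorem sum_conicWeight (hp : p ≠ 2) {n : ℕ} (hm : Module.finrank (ZMod p) F = n + 1)
    (f : ℤ → ℚ) :
    ∑ a : F, ∑ b : F, ∑ c : ZMod p, f (conicWeight a b c) =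
      f 0 + ((p : ℚ) - 1) * f ((p : ℤ) ^ (n + 1)) +
      (p : ℚ) * ((p : ℚ) ^ (n + 1) - 1) * f ((p : ℤ) ^ n * ((p : ℤ) - 1)) +
      (p : ℚ) ^ (n + 1) * ∑ a ∈ Finset.univ.erase (0 : F), ∑ t : ZMod p,
        f ((p : ℤ) ^ (n + 1) - traceSqCount a t +
          if Algebra.trace (ZMod p) F a = 0 then 0 else 1) := by
  have hcard : (Fintype.card F : ℤ) = (p : ℤ) ^ (n + 1) := by
    rw [card_eq_pow_of_finrank hm]; push_cast; rfl
  have hcardQ : (Fintype.card F : ℚ) = (p : ℚ) ^ (n + 1) := by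
    rw [card_eq_pow_of_finrank hm]; push_cast; rfl
  rw [← Finset.add_sum_erase _ _ (Finset.mem_univ (0 : F))]
  congr 1
  · rw [← Finset.add_sum_erase _ _ (Finset.mem_univ (0 : F)),
      ← Finset.add_sum_erase _ _ (Finset.mem_univ (0 : ZMod p)), conicWeight_zero_zero_zero]
    congr 1
    · congr 1
      rw [Finset.sum_congr rfl fun c hc => by
        rw [conicWeight_zero_zero (Finset.ne_of_mem_erase hc), hcard]]
      rw [Finset.sum_const, Finset.card_erase_of_mem (Finset.mem_univ _), Finset.card_univ,
        ZMod.card, nsmul_eq_mul, Nat.cast_sub (Fact.out : p.Prime).one_le, Nat.cast_one]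
    · rw [Finset.sum_congr rfl fun b hb => Finset.sum_congr rfl fun c _ => by
        rw [conicWeight_zero hm (Finset.ne_of_mem_erase hb)]]
      rw [Finset.sum_const, Finset.sum_const, Finset.card_erase_of_mem (Finset.mem_univ _),
        Finset.card_univ, Finset.card_univ, ZMod.card, nsmul_eq_mul, nsmul_eq_mul,
        Nat.cast_sub Fintype.card_pos, hcardQ, Nat.cast_one]
      ring
  · rw [Finset.mul_sum]
    refine Finset.sum_congr rfl fun a ha => ?_
    have h1 : ∀ b : F, ∑ c : ZMod p, f (conicWeight a b c) = ∑ t : ZMod p,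
        f ((p : ℤ) ^ (n + 1) - traceSqCount a t +
          if Algebra.trace (ZMod p) F a = 0 then 0 else 1) := by
      intro b
      refine Fintype.sum_equiv (Equiv.subLeft (Algebra.trace (ZMod p) F (b ^ 2 / (4 * a)))) _ _
        fun c => ?_
      rw [conicWeight_of_ne_zero hp (Finset.ne_of_mem_erase ha), hcard]
      rfl
    rw [Finset.sum_congr rfl fun b _ => h1 b, Finset.sum_const, Finset.card_univ, nsmul_eq_mul,
      hcardQ]

theorem sum_conicWeight_odd (hp : p ≠ 2) {k : ℕ} (hm : Module.finrank (ZMod p) F = 2 * k + 1)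
    (f : ℤ → ℚ) {D R : ℤ} (hD : D = (p : ℤ) ^ (2 * k) * ((p : ℤ) - 1))
    (hR : R = (p : ℤ) ^ k ∨ R = -(p : ℤ) ^ k) :
    ∑ a : F, ∑ b : F, ∑ c : ZMod p, f (conicWeight a b c) =
      f 0 + ((p : ℚ) - 1) * f ((p : ℤ) ^ (2 * k + 1)) +
      (p : ℚ) * ((p : ℚ) ^ (2 * k + 1) - 1) * f D +
      (p : ℚ) ^ (2 * k + 1) * (
        ((p : ℚ) ^ (2 * k) - 1) * (f D + ((p : ℚ) - 1) / 2 * (f (D - R) + f (D + R))) +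
        ((p : ℚ) ^ (2 * k + 1) - (p : ℚ) ^ (2 * k)) *
          (f (D + 1) + ((p : ℚ) - 1) / 2 * (f (D - R + 1) + f (D + R + 1)))) := by
  rw [sum_conicWeight hp hm, ← hD]
  congr 2
  have h1 : ∀ a ∈ Finset.univ.erase (0 : F), ∑ t : ZMod p,
        f ((p : ℤ) ^ (2 * k + 1) - traceSqCount a t +
          if Algebra.trace (ZMod p) F a = 0 then 0 else 1) =
      (fun d => f (D + d) + ((p : ℚ) - 1) / 2 * (f (D - R + d) + f (D + R + d)))
        (if Algebra.trace (ZMod p) F a = 0 then 0 else 1) := by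
    intro a ha
    obtain ⟨s, hs, h⟩ := traceSqCount_odd hp hm (Finset.ne_of_mem_erase ha)
    generalize (if Algebra.trace (ZMod p) F a = 0 then (0 : ℤ) else 1) = d
    have h2 := sum_comp_quadraticChar (ringChar_zmod_ne_two hp)
      fun z => f (D - s * z * (p : ℤ) ^ k + d)
    rw [ZMod.card] at h2
    have h3 : ∀ t : ZMod p, f ((p : ℤ) ^ (2 * k + 1) - traceSqCount a t + d) =
        f (D - s * quadraticChar (ZMod p) t * (p : ℤ) ^ k + d) := by
      intro t
      rw [h t, hD]
      congr 1
      ring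
    simp_rw [h3]
    rw [h2]
    -- The sum is symmetric under `R ↦ -R`, so all four sign choices agree.
    rcases hs with rfl | rfl <;> rcases hR with rfl | rfl <;> ring_nf
  rw [Finset.sum_congr rfl h1, sum_erase_zero_trace_eq hm
    fun d => f (D + d) + ((p : ℚ) - 1) / 2 * (f (D - R + d) + f (D + R + d))]
  simp only [add_zero]

theorem sum_conicWeight_even (hp : p ≠ 2) {k : ℕ}
    (hm : Module.finrank (ZMod p) F = 2 * k + 1 + 1)
    (f : ℤ → ℚ) {D R : ℤ} (hD : D = (p : ℤ) ^ (2 * k + 1) * ((p : ℤ) - 1))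
    (hR : R = (p : ℤ) ^ k * (-1) ^ ((k + 1) * (p / 2))) :
    ∑ a : F, ∑ b : F, ∑ c : ZMod p, f (conicWeight a b c) =
      f 0 + ((p : ℚ) - 1) * f ((p : ℤ) ^ (2 * k + 1 + 1)) +
      (p : ℚ) * ((p : ℚ) ^ (2 * k + 1 + 1) - 1) * f D +
      (p : ℚ) ^ (2 * k + 1 + 1) * (
        ((p : ℚ) ^ (2 * k + 1) - 1 - ((p : ℚ) - 1) * R) / 2 *
          (f (D + ((p : ℤ) - 1) * R) + ((p : ℚ) - 1) * f (D - R)) +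
        ((p : ℚ) ^ (2 * k + 1) - 1 + ((p : ℚ) - 1) * R) / 2 *
          (f (D - ((p : ℤ) - 1) * R) + ((p : ℚ) - 1) * f (D + R)) +
        ((p : ℚ) ^ (2 * k + 1 + 1) - (p : ℚ) ^ (2 * k + 1) + ((p : ℚ) - 1) * R) / 2 *
          (f (D + ((p : ℤ) - 1) * R + 1) + ((p : ℚ) - 1) * f (D - R + 1)) +
        ((p : ℚ) ^ (2 * k + 1 + 1) - (p : ℚ) ^ (2 * k + 1) - ((p : ℚ) - 1) * R) / 2 *
          (f (D - ((p : ℤ) - 1) * R + 1) + ((p : ℚ) - 1) * f (D + R + 1))) := by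
  rw [sum_conicWeight hp hm, ← hD]
  congr 2
  have hm' : Module.finrank (ZMod p) F = 2 * (k + 1) := by rw [hm]; ring
  have h1 : ∀ a ∈ Finset.univ.erase (0 : F), ∑ t : ZMod p,
        f ((p : ℤ) ^ (2 * k + 1 + 1) - traceSqCount a t +
          if Algebra.trace (ZMod p) F a = 0 then 0 else 1) =
      (fun z d => f (D + z * (((p : ℤ) - 1) * R) + d) + ((p : ℚ) - 1) * f (D - z * R + d))
        (quadraticChar F a) (if Algebra.trace (ZMod p) F a = 0 then 0 else 1) := by
    intro a ha
    generalize (if Algebra.trace (ZMod p) F a = 0 then (0 : ℤ) else 1) = d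
    rw [← Finset.add_sum_erase _ _ (Finset.mem_univ (0 : ZMod p))]
    have h3 : ∀ t ∈ Finset.univ.erase (0 : ZMod p),
        f ((p : ℤ) ^ (2 * k + 1 + 1) - traceSqCount a t + d) =
          f (D - quadraticChar F a * R + d) := by
      intro t ht
      rw [traceSqCount_even hp hm' (Finset.ne_of_mem_erase ha),
        if_neg (Finset.ne_of_mem_erase ht), ← hR, hD]
      congr 1
      ring
    rw [Finset.sum_congr rfl h3, Finset.sum_const, Finset.card_erase_of_mem (Finset.mem_univ _),
      Finset.card_univ, ZMod.card, nsmul_eq_mul, Nat.cast_sub (Fact.out : p.Prime).one_le,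
      Nat.cast_one, traceSqCount_even hp hm' (Finset.ne_of_mem_erase ha), if_pos rfl, ← hR]
    congr 2
    rw [hD]
    ring
  -- The character sum over the trace-zero hyperplane is found by comparing two formulas for the
  -- count at `a = 1`, `t = 0`.
  have hE : ∑ u : F with Algebra.trace (ZMod p) F u = 0, (quadraticChar F u : ℚ) =
      -(((p : ℚ) - 1) * R) := by
    have h2 := traceSqCount_eq_add_quadraticChar_mul hp hm (0 : ZMod p) (one_ne_zero (α := F))
    rw [traceSqCount_even hp hm' one_ne_zero, map_one, if_pos rfl, ← hR] at h2
    have h4 : ∑ u : F with Algebra.trace (ZMod p) F u = 0, quadraticChar F u =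
        -(((p : ℤ) - 1) * R) := by linear_combination -h2
    exact_mod_cast h4
  rw [Finset.sum_congr rfl h1, sum_erase_zero_quadraticChar_trace hp hm
    (fun z d => f (D + z * (((p : ℤ) - 1) * R) + d) + ((p : ℚ) - 1) * f (D - z * R + d)) hE]
  simp only [one_mul, neg_one_mul, add_zero, sub_neg_eq_add, ← sub_eq_add_neg]

end ConicWeight

/-! ### Minimum distance from a weight table. -/

section Codes

variable {K : Type*} [Field K] [DecidableEq K] {n : ℕ}

theorem isLeast_hammingDist_iff (C : Submodule K (Fin n → K)) (d : ℕ) :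
    IsLeast {w : ℕ | ∃ u ∈ C, ∃ v ∈ C, u ≠ v ∧ hammingDist u v = w} d ↔
      (∃ c ∈ C, c ≠ 0 ∧ hammingNorm c = d) ∧ ∀ c ∈ C, c ≠ 0 → d ≤ hammingNorm c := by
  constructor
  · rintro ⟨⟨u, hu, v, hv, huv, h⟩, hmin⟩
    refine ⟨⟨-u + v, C.add_mem (C.neg_mem hu) hv, ?_, ?_⟩, fun c hc hc0 => ?_⟩
    · rwa [ne_eq, neg_add_eq_zero]
    · rw [← h, hammingDist_eq_hammingNorm]
    · refine hmin ⟨0, C.zero_mem, c, hc, hc0.symm, ?_⟩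
      rw [hammingDist_zero_left]
  · rintro ⟨⟨c, hc, hc0, h⟩, hmin⟩
    refine ⟨⟨0, C.zero_mem, c, hc, hc0.symm, ?_⟩, ?_⟩
    · rw [hammingDist_zero_left, h]
    · rintro _ ⟨u, hu, v, hv, huv, rfl⟩
      rw [hammingDist_eq_hammingNorm]
      exact hmin _ (C.add_mem (C.neg_mem hu) hv) (by rwa [ne_eq, neg_add_eq_zero])

/-- Rows of equal weight are added, so nonnegativity of all multiplicities is what prevents the
positive row at `d` from being cancelled. -/
theorem HasWeightTable.isLeast [Fintype K] {C : Submodule K (Fin n → K)} {T : List (ℤ × ℚ)}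
    (hT : HasWeightTable C T) {d : ℕ} (hd : 0 < d) (hpos : ∀ r ∈ T, 0 ≤ r.2)
    (hle : ∀ r ∈ T, r.1 = 0 ∨ (d : ℤ) ≤ r.1) (hmem : ∃ r ∈ T, r.1 = d ∧ 0 < r.2) :
    IsLeast {w : ℕ | ∃ u ∈ C, ∃ v ∈ C, u ≠ v ∧ hammingDist u v = w} d := by
  rw [isLeast_hammingDist_iff]
  constructor
  · obtain ⟨r, hr, hrd, hr0⟩ := hmem
    have h : 0 < weightCount C d := by
      rw [← Nat.cast_pos (α := ℚ), hT d]
      refine lt_of_lt_of_le hr0 ?_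
      refine le_trans (le_of_eq (if_pos hrd).symm) (List.single_le_sum ?_ _
        (List.mem_map.2 ⟨r, hr, rfl⟩))
      intro y hy
      obtain ⟨r', hr', rfl⟩ := List.mem_map.1 hy
      split_ifs
      · exact hpos r' hr'
      · exact le_rfl
    obtain ⟨c, hc, hcd⟩ := Set.nonempty_of_ncard_ne_zero h.ne'
    refine ⟨c, hc, ?_, hcd⟩
    rw [← hammingNorm_pos_iff, hcd]
    exact hd
  · intro c hc hc0
    have h : 0 < weightCount C (hammingNorm c) := (Set.ncard_pos).2 ⟨c, hc, rfl⟩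
    rw [← Nat.cast_pos (α := ℚ), hT] at h
    by_contra hlt
    refine h.ne' (List.sum_eq_zero ?_)
    intro y hy
    obtain ⟨r, hr, rfl⟩ := List.mem_map.1 hy
    refine if_neg fun hrc => ?_
    have := hammingNorm_pos_iff.2 hc0
    rcases hle r hr with h0 | h0 <;> omega

end Codes

/-! ### The weight tables and the minimum distances. -/

section ConicTables

variable {p : ℕ} [Fact p.Prime] {F : Type*} [Field F] [Fintype F] [Algebra (ZMod p) F]

theorem hammingNorm_conicTraceMap_eq_conicWeight {q : ℕ} (x : Fin q ≃ F) (z : F × F × ZMod p) :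
    (hammingNorm (conicTraceMap (ZMod p) x z) : ℤ) = conicWeight z.1 z.2.1 z.2.2 := by
  rw [hammingNorm_conicTraceMap, conicWeight, ← Fintype.card_congr x, Fintype.card_fin]

/-- Take `f` to be the indicator of the weight `i`; by injectivity, counting parameters is counting
codewords. -/
theorem hasWeightTable_conicTraceMap (hp : p ≠ 2) {q : ℕ} (x : Fin q ≃ F) {T : List (ℤ × ℚ)}
    (hT : ∀ f : ℤ → ℚ, ∑ a : F, ∑ b : F, ∑ c : ZMod p, f (conicWeight a b c) =
      (T.map fun r => r.2 * f r.1).sum) :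
    HasWeightTable (LinearMap.range (conicTraceMap (ZMod p) x)) T := by
  intro i
  have h1 : {c : Fin (q + 1) → ZMod p | c ∈ LinearMap.range (conicTraceMap (ZMod p) x) ∧
      hammingNorm c = i} = conicTraceMap (ZMod p) x ''
        {z | conicWeight z.1 z.2.1 z.2.2 = (i : ℤ)} := by
    ext c
    constructor
    · rintro ⟨⟨z, rfl⟩, hz⟩
      exact ⟨z, by rw [Set.mem_ofPred_eq, ← hammingNorm_conicTraceMap_eq_conicWeight x, hz], rfl⟩
    · rintro ⟨z, hz, rfl⟩
      rw [Set.mem_ofPred_eq, ← hammingNorm_conicTraceMap_eq_conicWeight x] at hz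
      exact ⟨⟨z, rfl⟩, by exact_mod_cast hz⟩
  have h2 := hT fun w => if w = (i : ℤ) then 1 else 0
  simp only [mul_ite, mul_one, mul_zero] at h2
  rw [← h2, weightCount, h1,
    Set.ncard_image_of_injective _ (conicTraceMap_injective x (two_ne_zero_zmod hp)),
    Set.ncard_eq_toFinset_card', Set.toFinset_ofPred, Finset.card_filter, Fintype.sum_prod_type]
  simp only [Fintype.sum_prod_type]
  push_cast
  rfl

theorem finrank_range_conicTraceMap (hp : p ≠ 2) {q m : ℕ} (x : Fin q ≃ F)
    (hm : Module.finrank (ZMod p) F = m) :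
    Module.finrank (ZMod p) (LinearMap.range (conicTraceMap (ZMod p) x)) = 2 * m + 1 := by
  rw [LinearMap.finrank_range_of_inj (conicTraceMap_injective x (two_ne_zero_zmod hp)),
    Module.finrank_prod, Module.finrank_prod, hm, Module.finrank_self]
  ring

theorem hasWeightTable_conicTableOdd (hp : p ≠ 2) {q m : ℕ} (x : Fin q ≃ F)
    (hm : Module.finrank (ZMod p) F = m) (hodd : Odd m) :
    HasWeightTable (LinearMap.range (conicTraceMap (ZMod p) x)) (conicTableOdd p m) := by
  classical
  obtain ⟨k, rfl⟩ := hodd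
  refine hasWeightTable_conicTraceMap hp x fun f => ?_
  have hR : (p : ℤ) ^ ((2 * k + 1 - 1) / 2) * (-1) ^ ((p - 1) * (2 * k + 1 + 1) / 4) = (p : ℤ) ^ k ∨
      (p : ℤ) ^ ((2 * k + 1 - 1) / 2) * (-1) ^ ((p - 1) * (2 * k + 1 + 1) / 4) = -(p : ℤ) ^ k := by
    have : (2 * k + 1 - 1) / 2 = k := by omega
    rw [this]
    rcases neg_one_pow_eq_or ℤ ((p - 1) * (2 * k + 1 + 1) / 4) with h | h <;> simp [h]
  rw [sum_conicWeight_odd hp hm f (D := (p : ℤ) ^ (2 * k + 1 - 1) * ((p : ℤ) - 1)) rfl hR]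
  have h2 : 2 * (2 * k + 1) - 1 = 2 * k + (2 * k + 1) := by omega
  simp only [conicTableOdd, List.map_cons, List.map_nil, List.sum_cons, List.sum_nil, h2,
    Nat.add_sub_cancel]
  ring

theorem hasWeightTable_conicTableEven (hp : p ≠ 2) {q m : ℕ} (x : Fin q ≃ F)
    (hm : Module.finrank (ZMod p) F = m) (hm0 : 0 < m) (heven : Even m) :
    HasWeightTable (LinearMap.range (conicTraceMap (ZMod p) x)) (conicTableEven p m) := by
  classical
  obtain ⟨l, hl⟩ := heven
  obtain ⟨k, rfl⟩ : ∃ k, m = 2 * k + 1 + 1 := ⟨l - 1, by omega⟩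
  refine hasWeightTable_conicTraceMap hp x fun f => ?_
  have hk : (2 * k + 1 + 1 - 2) / 2 = k := by omega
  -- The division by 4 is exact because `p` is odd.
  have he : (2 * k + 1 + 1) * (p - 1) / 4 = (k + 1) * (p / 2) := by
    obtain ⟨r, hr⟩ := (Fact.out : p.Prime).odd_of_ne_two hp
    have h1 : p - 1 = 2 * r := by omega
    have h2 : p / 2 = r := by omega
    rw [h1, h2]
    have h3 : (2 * k + 1 + 1) * (2 * r) = 4 * ((k + 1) * r) := by ring
    rw [h3, Nat.mul_div_cancel_left _ (by norm_num)]
  rw [sum_conicWeight_even hp hm f (D := (p : ℤ) ^ (2 * k + 1 + 1 - 1) * ((p : ℤ) - 1)) rfl rfl]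
  simp only [conicTableEven, List.map_cons, List.map_nil, List.sum_cons, List.sum_nil, hk, he,
    Nat.add_sub_cancel]
  push_cast
  ring

end ConicTables

theorem conicTableOdd_nonneg {p m : ℕ} (hp : 1 ≤ p) : ∀ r ∈ conicTableOdd p m, 0 ≤ r.2 := by
  have hP : (1 : ℚ) ≤ p := by exact_mod_cast hp
  have h0 : (0 : ℚ) ≤ (p : ℚ) - 1 := sub_nonneg.2 hP
  have h1 : (0 : ℚ) ≤ (p : ℚ) ^ m - 1 := sub_nonneg.2 (one_le_pow₀ hP)
  have h2 : (0 : ℚ) ≤ (p : ℚ) ^ (m - 1) - 1 := sub_nonneg.2 (one_le_pow₀ hP)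
  have h3 : (0 : ℚ) ≤ (p : ℚ) ^ m - (p : ℚ) ^ (m - 1) :=
    sub_nonneg.2 (pow_le_pow_right₀ hP (Nat.sub_le m 1))
  simp only [conicTableOdd, List.forall_mem_cons, List.not_mem_nil, false_imp_iff, forall_const,
    and_true]
  refine ⟨?_, ?_, ?_, ?_, ?_, ?_, ?_, ?_⟩ <;> positivity

theorem isLeast_of_hasWeightTable_conicTableOdd {p m n : ℕ} [Fact p.Prime] (hp : p ≠ 2) (hm : 1 < m)
    (hodd : Odd m) {C : Submodule (ZMod p) (Fin n → ZMod p)}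
    (hT : HasWeightTable C (conicTableOdd p m)) :
    IsLeast {w : ℕ | ∃ u ∈ C, ∃ v ∈ C, u ≠ v ∧ hammingDist u v = w}
      (p ^ (m - 1) * (p - 1) - p ^ ((m - 1) / 2)) := by
  have hp3 : 3 ≤ p := by have := (Fact.out : p.Prime).two_le; omega
  obtain ⟨k, rfl⟩ := hodd
  have hk : (2 * k + 1 - 1) / 2 = k := by omega
  have ha : p ≤ p ^ k := Nat.le_self_pow (by omega) p
  -- Makes the natural-number subtraction in the minimum distance genuine and its result positive.
  have hD : p ^ k + 1 ≤ p ^ (2 * k) * (p - 1) := by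
    obtain ⟨r, rfl⟩ : ∃ r, p = r + 1 := ⟨p - 1, by omega⟩
    rw [two_mul, pow_add, Nat.add_sub_cancel]
    nlinarith [Nat.mul_le_mul ha (show 2 ≤ r by omega)]
  have hcast : ((p ^ (2 * k + 1 - 1) * (p - 1) - p ^ ((2 * k + 1 - 1) / 2) : ℕ) : ℤ) =
      (p : ℤ) ^ (2 * k) * ((p : ℤ) - 1) - (p : ℤ) ^ k := by
    rw [hk, Nat.add_sub_cancel, Nat.cast_sub (by omega), Nat.cast_mul, Nat.cast_sub (by omega)]
    push_cast
    rfl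
  have hR : (p : ℤ) ^ ((2 * k + 1 - 1) / 2) * (-1) ^ ((p - 1) * (2 * k + 1 + 1) / 4) = (p : ℤ) ^ k ∨
      (p : ℤ) ^ ((2 * k + 1 - 1) / 2) * (-1) ^ ((p - 1) * (2 * k + 1 + 1) / 4) = -(p : ℤ) ^ k := by
    rw [hk]
    rcases neg_one_pow_eq_or ℤ ((p - 1) * (2 * k + 1 + 1) / 4) with h | h <;> simp [h]
  have ha0 : (0 : ℤ) ≤ (p : ℤ) ^ k := by positivity
  have hA0 : (0 : ℤ) ≤ (p : ℤ) ^ (2 * k) := by positivity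
  refine hT.isLeast ?_ (conicTableOdd_nonneg (by omega)) ?_ ?_
  · rw [hk, Nat.add_sub_cancel]
    omega
  · rw [hcast]
    simp only [conicTableOdd, List.forall_mem_cons, List.not_mem_nil, false_imp_iff, forall_const,
      and_true]
    refine ⟨Or.inl trivial, Or.inr ?_, Or.inr ?_, Or.inr ?_, Or.inr ?_, Or.inr ?_, Or.inr ?_,
      Or.inr ?_⟩
    · rw [pow_succ]
      linarith
    all_goals
      rw [Nat.add_sub_cancel] at *
      rcases hR with h | h <;> linarith
  · have hmul : (0 : ℚ) < (p : ℚ) ^ (2 * k + 1) * ((p : ℚ) ^ (2 * k) - 1) * ((p : ℚ) - 1) / 2 := by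
      have hP : (1 : ℚ) < p := by exact_mod_cast (by omega : 1 < p)
      have h1 : (0 : ℚ) < (p : ℚ) - 1 := sub_pos.2 hP
      have h2 : (0 : ℚ) < (p : ℚ) ^ (2 * k) - 1 := sub_pos.2 (one_lt_pow₀ hP (by omega))
      positivity
    rw [hcast]
    -- The minimum is attained in the row `D - R` or `D + R` (indices from zero), according to the
    -- sign of `R`.
    rcases hR with h | h
    · refine ⟨_, List.mem_of_getElem? (i := 4) rfl, ?_, hmul⟩
      change (p : ℤ) ^ (2 * k) * ((p : ℤ) - 1) - _ = _
      rw [h]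
    · refine ⟨_, List.mem_of_getElem? (i := 6) rfl, ?_, hmul⟩
      change (p : ℤ) ^ (2 * k) * ((p : ℤ) - 1) + _ = _
      rw [h]
      ring

theorem isLeast_of_hasWeightTable_conicTableEven {p m n : ℕ} [Fact p.Prime] (hp : p ≠ 2)
    (hm : 1 < m) (heven : Even m) {C : Submodule (ZMod p) (Fin n → ZMod p)}
    (hT : HasWeightTable C (conicTableEven p m)) :
    IsLeast {w : ℕ | ∃ u ∈ C, ∃ v ∈ C, u ≠ v ∧ hammingDist u v = w}
      (p ^ (m - 1) * (p - 1) - (p - 1) * p ^ ((m - 2) / 2)) := by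
  have hp3 : 3 ≤ p := by have := (Fact.out : p.Prime).two_le; omega
  obtain ⟨l, hl⟩ := heven
  obtain ⟨k, rfl⟩ : ∃ k, m = 2 * k + 2 := ⟨l - 1, by omega⟩
  have hk : (2 * k + 2 - 2) / 2 = k := by omega
  have hk1 : 2 * k + 2 - 1 = 2 * k + 1 := by omega
  have ha : 1 ≤ p ^ k := Nat.one_le_pow _ _ (by omega)
  have hD : p ^ k + 1 ≤ p ^ (2 * k + 1) := by
    rw [pow_succ, two_mul, pow_add]
    nlinarith [Nat.mul_le_mul ha ha, Nat.mul_le_mul (Nat.mul_le_mul ha (le_refl (p ^ k))) hp3]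
  have hcast : ((p ^ (2 * k + 2 - 1) * (p - 1) - (p - 1) * p ^ ((2 * k + 2 - 2) / 2) : ℕ) : ℤ) =
      (p : ℤ) ^ (2 * k + 1) * ((p : ℤ) - 1) - ((p : ℤ) - 1) * (p : ℤ) ^ k := by
    rw [hk, hk1, mul_comm, ← Nat.mul_sub, Nat.cast_mul, Nat.cast_sub (by omega),
      Nat.cast_sub (by omega)]
    push_cast
    ring
  have hs := neg_one_pow_eq_or ℤ ((2 * k + 2) * (p - 1) / 4)
  have hsQ : (-1 : ℤ) ^ ((2 * k + 2) * (p - 1) / 4) = 1 →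
      (-1 : ℚ) ^ ((2 * k + 2) * (p - 1) / 4) = 1 := by
    intro h; exact_mod_cast h
  have hsQ' : (-1 : ℤ) ^ ((2 * k + 2) * (p - 1) / 4) = -1 →
      (-1 : ℚ) ^ ((2 * k + 2) * (p - 1) / 4) = -1 := by
    intro h; exact_mod_cast h
  have hP : (3 : ℚ) ≤ p := by exact_mod_cast hp3
  have hPZ : (3 : ℤ) ≤ p := by exact_mod_cast hp3
  have haQ : (1 : ℚ) ≤ (p : ℚ) ^ k := one_le_pow₀ (by linarith)
  have haZ : (1 : ℤ) ≤ (p : ℤ) ^ k := one_le_pow₀ (by linarith)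
  have hAQ : (p : ℚ) ^ k * p ≤ (p : ℚ) ^ (2 * k + 1) := by
    rw [pow_succ, two_mul, pow_add]
    nlinarith [mul_le_mul_of_nonneg_right haQ (by positivity : (0 : ℚ) ≤ (p : ℚ) ^ k * p)]
  have hAZ : (0 : ℤ) ≤ (p : ℤ) ^ (2 * k + 1) := by positivity
  have hMQ : (0 : ℚ) < (p : ℚ) ^ (2 * k + 2) := by positivity
  have hRZ : 0 ≤ ((p : ℤ) - 2) * (p : ℤ) ^ k := mul_nonneg (by linarith) (by linarith)
  have hRZ' : 0 ≤ ((p : ℤ) - 1) * (p : ℤ) ^ k := mul_nonneg (by linarith) (by linarith)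
  have hP1 : (0 : ℚ) < (p : ℚ) - 1 := by linarith
  -- Not strict: for `m = 2` this is zero and the corresponding rows are empty.
  have hf1 : (0 : ℚ) ≤ (p : ℚ) ^ (2 * k + 1) - 1 - ((p : ℚ) - 1) * (p : ℚ) ^ k := by linarith
  have hf2 : (0 : ℚ) < (p : ℚ) ^ (2 * k + 1) - 1 + ((p : ℚ) - 1) * (p : ℚ) ^ k := by
    nlinarith
  have hf3 : (0 : ℚ) ≤ (p : ℚ) ^ (2 * k + 1) + (p : ℚ) ^ k := by positivity
  have hf4 : (0 : ℚ) ≤ (p : ℚ) ^ (2 * k + 1) - (p : ℚ) ^ k := by nlinarith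
  have hf5 : (0 : ℚ) ≤ (p : ℚ) ^ (2 * k + 2) - 1 := sub_nonneg.2 (one_le_pow₀ (by linarith))
  have hd : 0 < p ^ (2 * k + 2 - 1) * (p - 1) - (p - 1) * p ^ ((2 * k + 2 - 2) / 2) := by
    rw [hk, hk1, mul_comm, ← Nat.mul_sub]
    exact Nat.mul_pos (by omega) (by omega)
  -- The minimum is in the row `D - (p - 1) R` for positive `R` and in `D + (p - 1) R` for negative
  -- `R`; both have the strictly positive factor `hf2`.
  rcases hs with h | h
  · have hq := hsQ h
    refine hT.isLeast hd ?_ ?_ ?_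
    · simp only [conicTableEven, List.forall_mem_cons, List.not_mem_nil, false_imp_iff,
        forall_const, and_true, hk, hk1, h, hq, mul_one]
      refine ⟨?_, ?_, ?_, ?_, ?_, ?_, ?_, ?_, ?_, ?_, ?_⟩ <;> positivity
    · rw [hcast]
      simp only [conicTableEven, List.forall_mem_cons, List.not_mem_nil, false_imp_iff,
        forall_const, and_true, hk, hk1, h, hq, mul_one]
      refine ⟨Or.inl trivial, ?_, ?_, ?_, ?_, ?_, ?_, ?_, ?_, ?_, ?_⟩ <;> right
      · rw [pow_succ _ (2 * k + 1)]; linarith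
      all_goals linarith
    · rw [hcast]
      refine ⟨_, List.mem_of_getElem? (i := 5) rfl, ?_, ?_⟩ <;>
        simp only [hk, hk1, h, hq, mul_one]
      positivity
  · have hq := hsQ' h
    refine hT.isLeast hd ?_ ?_ ?_
    · simp only [conicTableEven, List.forall_mem_cons, List.not_mem_nil, false_imp_iff,
        forall_const, and_true, hk, hk1, h, hq, mul_neg, mul_one, sub_neg_eq_add, ← sub_eq_add_neg]
      refine ⟨?_, ?_, ?_, ?_, ?_, ?_, ?_, ?_, ?_, ?_, ?_⟩ <;> positivity
    · rw [hcast]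
      simp only [conicTableEven, List.forall_mem_cons, List.not_mem_nil, false_imp_iff,
        forall_const, and_true, hk, hk1, h, hq, mul_neg, mul_one, sub_neg_eq_add, ← sub_eq_add_neg]
      refine ⟨Or.inl trivial, ?_, ?_, ?_, ?_, ?_, ?_, ?_, ?_, ?_, ?_⟩ <;> right
      · rw [pow_succ _ (2 * k + 1)]; linarith
      all_goals linarith
    · rw [hcast]
      refine ⟨_, List.mem_of_getElem? (i := 3) rfl, ?_, ?_⟩ <;>
        simp only [hk, hk1, h, hq, mul_neg, mul_one, sub_neg_eq_add, ← sub_eq_add_neg]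
      positivity

/-! ### The dual code has minimum distance 4. -/

section DualCode

theorem finrank_dualCode {K : Type*} [Field K] {n : ℕ} (C : Submodule K (Fin n → K)) :
    Module.finrank K (dualCode C) = n - Module.finrank K C := by
  have h : dualCode C =
      Submodule.dualCoannihilator (C.map (dotProductEquiv K (Fin n)).toLinearMap) := by
    ext v
    rw [Submodule.mem_dualCoannihilator]
    constructor
    · rintro h _ ⟨c, hc, rfl⟩
      exact h c hc
    · intro h c hc
      exact h _ ⟨c, hc, rfl⟩
  have h2 := Subspace.finrank_add_finrank_dualCoannihilator_eq
    (C.map (dotProductEquiv K (Fin n)).toLinearMap)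
  rw [LinearEquiv.finrank_map_eq, ← h, Module.finrank_fin_fun] at h2
  omega

variable {K L : Type*} [Field K] [Field L] [Algebra K L] {q : ℕ}

/-- Scaling `(a, b, c)` by every `r` in `L` and using nondegeneracy of the trace lifts orthogonality
over `K` to a relation over `L`. -/
theorem sum_smul_eq_zero_of_mem_dualCode [FiniteDimensional K L] [Algebra.IsSeparable K L]
    (x : Fin q ≃ L) {v : Fin (q + 1) → K}
    (hv : v ∈ dualCode (LinearMap.range (conicTraceMap K x))) (a b c : L) :
    ∑ j : Fin q, v j.castSucc • (a * x j ^ 2 + b * x j + c) + v (Fin.last q) • a = 0 := by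
  refine (traceForm_nondegenerate K L).1 _ fun r => ?_
  have h := hv _ ⟨(r * a, r * b, Algebra.trace K L (r * c)), rfl⟩
  rw [dotProduct, Fin.sum_univ_castSucc] at h
  simp only [conicTraceMap_castSucc, conicTraceMap_last] at h
  rw [Algebra.traceForm_apply, add_mul, Finset.sum_mul, map_add, map_sum, ← h]
  congr 1
  · refine Finset.sum_congr rfl fun j _ => ?_
    rw [smul_mul_assoc, map_smul, smul_eq_mul, mul_comm, ← map_add]
    congr 2
    ring
  · rw [smul_mul_assoc, map_smul, smul_eq_mul, mul_comm, mul_comm a]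

theorem sum_smul_eval_eq_zero_of_mem_dualCode [FiniteDimensional K L] [Algebra.IsSeparable K L]
    (x : Fin q ≃ L) {v : Fin (q + 1) → K}
    (hv : v ∈ dualCode (LinearMap.range (conicTraceMap K x))) {g : Polynomial L}
    (hg : g.natDegree ≤ 2) :
    ∑ j : Fin q, v j.castSucc • g.eval (x j) + v (Fin.last q) • g.coeff 2 = 0 := by
  rw [← sum_smul_eq_zero_of_mem_dualCode x hv (g.coeff 2) (g.coeff 1) (g.coeff 0)]
  congr 1
  refine Finset.sum_congr rfl fun j _ => ?_
  rw [Polynomial.eval_eq_sum_range' (Nat.lt_succ_of_le hg), Finset.sum_range_succ,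
    Finset.sum_range_succ, Finset.sum_range_one]
  congr 1
  ring

theorem four_le_hammingNorm_of_mem_dualCode [DecidableEq K] [FiniteDimensional K L]
    [Algebra.IsSeparable K L] (x : Fin q ≃ L) {v : Fin (q + 1) → K}
    (hv : v ∈ dualCode (LinearMap.range (conicTraceMap K x))) (hv0 : v ≠ 0) :
    4 ≤ hammingNorm v := by
  by_contra hlt
  rw [hammingNorm_eq_add_last] at hlt
  set S : Finset (Fin q) := Finset.univ.filter fun j => v j.castSucc ≠ 0 with hS
  change ¬ 4 ≤ S.card + _ at hlt
  by_cases hSe : S.Nonempty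
  · obtain ⟨j, hj⟩ := hSe
    -- This polynomial vanishes at every affine support point except `x j`, and has degree at most 2
    -- when the weight is at most 3, so the relation isolates `v j`.
    let g : Polynomial L := ∏ i ∈ S.erase j, (Polynomial.X - Polynomial.C (x i))
    have hdeg : g.natDegree = S.card - 1 := by
      rw [Polynomial.natDegree_finsetProd_X_sub_C_eq_card, Finset.card_erase_of_mem hj]
    have h := sum_smul_eval_eq_zero_of_mem_dualCode x hv (g := g) (by rw [hdeg]; omega)
    -- If the last coordinate is in the support, at most two affine points remain, so `g` has degree
    -- at most 1.
    have hlast : v (Fin.last q) • g.coeff 2 = 0 := by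
      by_cases h0 : v (Fin.last q) = 0
      · rw [h0, zero_smul]
      · rw [if_neg h0] at hlt
        rw [Polynomial.coeff_eq_zero_of_natDegree_lt (by omega), smul_zero]
    rw [hlast, add_zero, Finset.sum_eq_single j] at h
    · rcases smul_eq_zero.1 h with h0 | h0
      · exact (Finset.mem_filter.1 hj).2 h0
      · rw [Polynomial.eval_prod, Finset.prod_eq_zero_iff] at h0
        obtain ⟨i, hi, h1⟩ := h0
        rw [Polynomial.eval_sub, Polynomial.eval_X, Polynomial.eval_C, sub_eq_zero] at h1
        exact (Finset.ne_of_mem_erase hi) (x.injective h1).symm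
    · intro i _ hij
      by_cases hi : i ∈ S
      · rw [Polynomial.eval_prod, Finset.prod_eq_zero (Finset.mem_erase.2 ⟨hij, hi⟩) (by simp),
          smul_zero]
      · have : v i.castSucc = 0 := by simpa [hS] using hi
        rw [this, zero_smul]
    · simp
  · have hz : ∀ j : Fin q, v j.castSucc = 0 := by
      intro j
      by_contra hj
      exact hSe ⟨j, by simpa [hS] using hj⟩
    have h := sum_smul_eq_zero_of_mem_dualCode x hv 1 0 0
    simp only [hz, zero_smul, Finset.sum_const_zero, zero_add] at h
    apply hv0
    ext j
    refine Fin.lastCases ?_ (fun j => hz j) j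
    exact (smul_eq_zero.1 h).resolve_right one_ne_zero

theorem exists_mem_dualCode_hammingNorm_le_four [DecidableEq K]
    (x : Fin q ≃ L) (h2 : (2 : K) ≠ 0) (h3 : (3 : K) ≠ 0) :
    ∃ v ∈ dualCode (LinearMap.range (conicTraceMap K x)), v ≠ 0 ∧ hammingNorm v ≤ 4 := by
  let e : K → Fin (q + 1) := fun r => (x.symm (algebraMap K L r)).castSucc
  have he : Function.Injective e := (Fin.castSucc_injective q).comp
    (x.symm.injective.comp (algebraMap K L).injective)
  have hval : ∀ z r, conicTraceMap K x z (e r) =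
      r ^ 2 * Algebra.trace K L z.1 + r * Algebra.trace K L z.2.1 + z.2.2 := by
    intro z r
    have h1 : z.1 * (algebraMap K L r) ^ 2 = r ^ 2 • z.1 := by
      rw [Algebra.smul_def, map_pow, mul_comm]
    have h2 : z.2.1 * algebraMap K L r = r • z.2.1 := by
      rw [Algebra.smul_def, mul_comm]
    rw [conicTraceMap_castSucc, Equiv.apply_symm_apply, h1, h2, map_add, map_smul, map_smul,
      smul_eq_mul, smul_eq_mul]
  -- The coefficients of the third finite difference, which annihilates quadratics: on points of `K`
  -- every codeword is a quadratic polynomial over `K`.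
  refine ⟨Pi.single (e 0) 1 + Pi.single (e 1) (-3) + Pi.single (e 2) 3 + Pi.single (e 3) (-1),
    ?_, ?_, ?_⟩
  · rintro _ ⟨z, rfl⟩
    simp only [dotProduct_add, dotProduct_single, hval]
    ring
  · intro h
    have h0 := congrFun h (e 0)
    have h01 : e 0 ≠ e 1 := he.ne zero_ne_one
    have h02 : e 0 ≠ e 2 := he.ne h2.symm
    have h03 : e 0 ≠ e 3 := he.ne h3.symm
    simp [h01, h02, h03] at h0
  · have hsub : (Finset.univ.filter fun j => (Pi.single (e 0) 1 + Pi.single (e 1) (-3) +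
        Pi.single (e 2) 3 + Pi.single (e 3) (-1) : Fin (q + 1) → K) j ≠ 0) ⊆
        {e 0, e 1, e 2, e 3} := by
      intro j hj
      by_contra hcon
      simp only [Finset.mem_insert, Finset.mem_singleton, not_or] at hcon
      refine (Finset.mem_filter.1 hj).2 ?_
      simp [hcon.1, hcon.2.1, hcon.2.2.1, hcon.2.2.2]
    exact (Finset.card_le_card hsub).trans Finset.card_le_four

end DualCode

/-! ### Sphere packing and distance-optimality. -/

section SpherePacking

theorem two_mul_card_filter_lt (n : ℕ) :
    2 * (Finset.univ.filter fun s : Fin n × Fin n => s.1 < s.2).card = n * (n - 1) := by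
  have h1 : (Finset.univ.filter fun s : Fin n × Fin n => s.2 < s.1).card =
      (Finset.univ.filter fun s : Fin n × Fin n => s.1 < s.2).card :=
    Finset.card_equiv (Equiv.prodComm _ _) fun s => by simp
  have h2 : (Finset.univ : Finset (Fin n)).offDiag =
      (Finset.univ.filter fun s : Fin n × Fin n => s.1 < s.2) ∪
        (Finset.univ.filter fun s : Fin n × Fin n => s.2 < s.1) := by
    ext s
    simp [lt_or_lt_iff_ne]
  have h3 := Finset.offDiag_card (Finset.univ : Finset (Fin n))
  rw [h2, Finset.card_union_of_disjoint, h1, Finset.card_univ, Fintype.card_fin] at h3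
  · rw [two_mul, h3, Nat.mul_sub_one]
  · rw [Finset.disjoint_filter]
    exact fun s _ h h' => lt_asymm h h'

variable {K : Type*} [Field K] {n : ℕ}

theorem hammingNorm_single_add_single_le [DecidableEq K] (i j : Fin n) (α β : K) :
    hammingNorm (Pi.single i α + Pi.single j β : Fin n → K) ≤ 2 := by
  have hsub : (Finset.univ.filter fun l => (Pi.single i α + Pi.single j β : Fin n → K) l ≠ 0) ⊆
      {i, j} := by
    intro l hl
    by_contra hcon
    simp only [Finset.mem_insert, Finset.mem_singleton, not_or] at hcon
    refine (Finset.mem_filter.1 hl).2 ?_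
    simp [hcon.1, hcon.2]
  exact (Finset.card_le_card hsub).trans Finset.card_le_two

theorem eq_of_single_add_single_eq {i j i' j' : Fin n} (hij : i < j) (hij' : i' < j')
    {α β α' β' : K} (hα : α ≠ 0) (hβ : β ≠ 0)
    (h : (Pi.single i α + Pi.single j β : Fin n → K) = Pi.single i' α' + Pi.single j' β') :
    i = i' ∧ j = j' ∧ α = α' ∧ β = β' := by
  have hi := congrFun h i
  have hj := congrFun h j
  simp only [Pi.add_apply, Pi.single_eq_same, Pi.single_eq_of_ne hij.ne,
    Pi.single_eq_of_ne hij.ne', add_zero, zero_add] at hi hj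
  have hi' : i = i' ∨ i = j' := by
    by_contra hcon
    rw [not_or] at hcon
    rw [Pi.single_eq_of_ne hcon.1, Pi.single_eq_of_ne hcon.2, add_zero] at hi
    exact hα hi
  have hj' : j = i' ∨ j = j' := by
    by_contra hcon
    rw [not_or] at hcon
    rw [Pi.single_eq_of_ne hcon.1, Pi.single_eq_of_ne hcon.2, add_zero] at hj
    exact hβ hj
  have h1 : i = i' := by
    rcases hi' with h1 | h1
    · exact h1
    · rcases hj' with h2 | h2
      · subst h1 h2; exact absurd hij (lt_asymm hij')
      · subst h1 h2; exact absurd hij (lt_irrefl _)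
  subst h1
  have h2 : j = j' := hj'.resolve_left hij.ne'
  subst h2
  simp only [Pi.single_eq_same, Pi.single_eq_of_ne hij.ne, Pi.single_eq_of_ne hij.ne', add_zero,
    zero_add] at hi hj
  exact ⟨rfl, rfl, hi, hj⟩

/-- The sphere-packing bound for codes of minimum distance `5`, with only the vectors of weight
`2` counted. -/
theorem IsLinearCode.card_weight_two_mul_le [DecidableEq K] [Fintype K] {k : ℕ}
    {C : Submodule K (Fin n → K)}
    (hC : IsLinearCode n k 5 C) :
    n * (n - 1) * (Fintype.card K - 1) ^ 2 * Fintype.card K ^ k ≤ 2 * Fintype.card K ^ n := by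
  classical
  have hmin := ((isLeast_hammingDist_iff C 5).1 hC.2).2
  -- Codeword plus vector of weight two. This is injective: two vectors of weight two are at
  -- distance at most 4, below the distance 5 of distinct codewords.
  let f : ({s : Fin n × Fin n // s.1 < s.2} × (Kˣ × Kˣ)) × C → (Fin n → K) := fun z =>
    (Pi.single z.1.1.1.1 (z.1.2.1 : K) + Pi.single z.1.1.1.2 (z.1.2.2 : K)) + (z.2 : Fin n → K)
  have hf : Function.Injective f := by
    rintro ⟨⟨⟨⟨i, j⟩, hij⟩, α, β⟩, c⟩ ⟨⟨⟨⟨i', j'⟩, hij'⟩, α', β'⟩, c'⟩ h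
    simp only [f] at h hij hij'
    have hc : (c : Fin n → K) = c' := by
      by_contra hne
      have h1 := hmin (-(c' : Fin n → K) + c) (C.add_mem (C.neg_mem c'.2) c.2)
        (by rw [ne_eq, neg_add_eq_zero]; exact fun h => hne h.symm)
      rw [← hammingDist_eq_hammingNorm] at h1
      have h2 : hammingDist (c' : Fin n → K) c = hammingDist
          (Pi.single i (α : K) + Pi.single j (β : K) : Fin n → K)
          (Pi.single i' (α' : K) + Pi.single j' (β' : K)) := by
        rw [hammingDist_eq_hammingNorm, hammingDist_eq_hammingNorm]
        congr 1
        linear_combination (exp := 1) h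
      have h3 := hammingDist_triangle (Pi.single i (α : K) + Pi.single j (β : K) : Fin n → K) 0
        (Pi.single i' (α' : K) + Pi.single j' (β' : K))
      rw [hammingDist_zero_right, hammingDist_zero_left] at h3
      have h4 := hammingNorm_single_add_single_le i j (α : K) β
      have h5 := hammingNorm_single_add_single_le i' j' (α' : K) β'
      omega
    rw [hc, add_left_inj] at h
    obtain ⟨rfl, rfl, h1, h2⟩ := eq_of_single_add_single_eq hij hij' α.ne_zero β.ne_zero h
    obtain rfl := Units.ext h1
    obtain rfl := Units.ext h2
    obtain rfl := Subtype.ext hc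
    rfl
  have hcard := Fintype.card_le_of_injective f hf
  rw [Fintype.card_prod, Fintype.card_prod, Fintype.card_prod, Fintype.card_units,
    Module.card_eq_pow_finrank (K := K) (V := C), hC.1, Fintype.card_fun, Fintype.card_fin,
    Fintype.card_subtype] at hcard
  rw [← two_mul_card_filter_lt]
  calc _ = 2 * _ := by ring
    _ ≤ _ := Nat.mul_le_mul_left 2 hcard

theorem two_mul_le_pow {p m : ℕ} (hp : 4 ≤ p) : 2 * m ≤ p ^ m := by
  have h1 : m + 1 ≤ 2 ^ m := Nat.lt_two_pow_self
  have h2 : (2 ^ m) * (2 ^ m) ≤ p ^ m := by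
    rw [← mul_pow]
    exact Nat.pow_le_pow_left hp m
  nlinarith [Nat.mul_le_mul h1 h1]

theorem sphere_packing_fails {p m : ℕ} (hp : 5 ≤ p) :
    2 * p ^ (p ^ m + 1) <
      (p ^ m + 1) * (p ^ m + 1 - 1) * (p - 1) ^ 2 * p ^ (p ^ m - 2 * m) := by
  have hk : p ^ m + 1 = (2 * m + 1) + (p ^ m - 2 * m) := by
    have := two_mul_le_pow (p := p) (m := m) (by omega)
    omega
  have h0 : 0 < p ^ (p ^ m - 2 * m) := by positivity
  have h1 : p ^ (p ^ m + 1) = p ^ m * p ^ m * p * p ^ (p ^ m - 2 * m) := by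
    conv_lhs => rw [hk]
    rw [pow_add, pow_succ, two_mul, pow_add]
  rw [h1, ← mul_assoc, Nat.add_sub_cancel]
  refine Nat.mul_lt_mul_of_pos_right ?_ h0
  have ha : 0 < p ^ m := by positivity
  generalize p ^ m = a at ha
  obtain ⟨r, rfl⟩ : ∃ r, p = r + 1 := ⟨p - 1, by omega⟩
  rw [Nat.add_sub_cancel]
  -- After cancelling `p ^ (p ^ m - 2 * m)`, everything rests on `2 p ≤ (p - 1)²`, which fails for
  -- `p = 3`.
  have h2 : 2 * (r + 1) ≤ r ^ 2 := by nlinarith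
  have h3 : 0 < a * r ^ 2 := Nat.mul_pos ha (pow_pos (by omega) 2)
  calc 2 * (a * a * (r + 1)) = a * a * (2 * (r + 1)) := by ring
    _ ≤ a * a * r ^ 2 := Nat.mul_le_mul_left _ h2
    _ < a * a * r ^ 2 + a * r ^ 2 := Nat.lt_add_of_pos_right h3
    _ = (a + 1) * a * r ^ 2 := by ring

theorem not_spherePackingBound {p m d : ℕ} (hp : 5 ≤ p) (hd : 4 < d) :
    ¬ SpherePackingBound p (p ^ m + 1) (p ^ m - 2 * m) d := by
  intro h
  rw [SpherePackingBound] at h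
  -- Since `d ≥ 5`, the radius is at least 2, and the term `i = 2` alone already violates the bound.
  have h2 : (p ^ m + 1).choose 2 * (p - 1) ^ 2 ≤
      ∑ i ∈ Finset.range ((d - 1) / 2 + 1), (p ^ m + 1).choose i * (p - 1) ^ i :=
    Finset.single_le_sum (f := fun i => (p ^ m + 1).choose i * (p - 1) ^ i)
      (fun _ _ => Nat.zero_le _) (Finset.mem_range.2 (by omega))
  have h3 := (Nat.mul_le_mul_left (p ^ (p ^ m - 2 * m)) h2).trans h
  have h4 : (p ^ m + 1) * (p ^ m + 1 - 1) = 2 * (p ^ m + 1).choose 2 := by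
    rw [Nat.choose_two_right, Nat.mul_div_cancel' (Nat.even_mul_pred_self _).two_dvd]
  have h5 := sphere_packing_fails (m := m) hp
  rw [h4] at h5
  nlinarith

end SpherePacking

/-! ### The three statements combined. -/

theorem theorem7 (p m : ℕ) [Fact p.Prime] (hp : Odd p) (hm : 1 < m)
    {F : Type*} [Field F] [Algebra (ZMod p) F]
    (x : Fin (p ^ m) ≃ F)
    (G : Matrix (Fin 3) (Fin (p ^ m + 1)) F) (hG : IsGeneratorMatrix G (conicCode x))
    (b : Module.Basis (Fin m) (ZMod p) F) :
    (Odd m →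
      IsLinearCode (p ^ m + 1) (2 * m + 1) (p ^ (m - 1) * (p - 1) - p ^ ((m - 1) / 2))
          (subfieldCode b G) ∧
        HasWeightTable (subfieldCode b G) (conicTableOdd p m)) ∧
    (Even m →
      IsLinearCode (p ^ m + 1) (2 * m + 1)
          (p ^ (m - 1) * (p - 1) - (p - 1) * p ^ ((m - 2) / 2)) (subfieldCode b G) ∧
        HasWeightTable (subfieldCode b G) (conicTableEven p m)) ∧
    (3 < p →
      IsLinearCode (p ^ m + 1) (p ^ m - 2 * m) 4 (dualCode (subfieldCode b G)) ∧
        IsDistanceOptimal (p ^ m + 1) (p ^ m - 2 * m) 4 (dualCode (subfieldCode b G)) ∧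
        ∀ d : ℕ, 4 < d → ¬ SpherePackingBound p (p ^ m + 1) (p ^ m - 2 * m) d) := by
  have : Fintype F := Fintype.ofEquiv _ x
  have hp2 : p ≠ 2 := by rintro rfl; exact absurd hp (by decide)
  have hfin : Module.finrank (ZMod p) F = m := by
    rw [Module.finrank_eq_card_basis b, Fintype.card_fin]
  rw [subfieldCode_conic_eq_range x b hG]
  have hdim := finrank_range_conicTraceMap hp2 x hfin
  refine ⟨fun hodd => ?_, fun heven => ?_, fun hp3 => ?_⟩
  · have hT := hasWeightTable_conicTableOdd hp2 x hfin hodd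
    exact ⟨⟨hdim, isLeast_of_hasWeightTable_conicTableOdd hp2 hm hodd hT⟩, hT⟩
  · have hT := hasWeightTable_conicTableEven hp2 x hfin (by omega) heven
    exact ⟨⟨hdim, isLeast_of_hasWeightTable_conicTableEven hp2 hm heven hT⟩, hT⟩
  · have hp5 : 5 ≤ p := by
      obtain ⟨r, hr⟩ := hp
      omega
    have h3 : (3 : ZMod p) ≠ 0 := by
      intro h
      have h' : ((3 : ℕ) : ZMod p) = 0 := by exact_mod_cast h
      rw [ZMod.natCast_eq_zero_iff] at h'
      exact absurd (Nat.le_of_dvd (by norm_num) h') (by omega)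
    have hcode : IsLinearCode (p ^ m + 1) (p ^ m - 2 * m) 4
        (dualCode (LinearMap.range (conicTraceMap (ZMod p) x))) := by
      refine ⟨?_, ?_⟩
      · rw [finrank_dualCode, hdim]
        omega
      · rw [isLeast_hammingDist_iff]
        obtain ⟨v, hv, hv0, hv4⟩ :=
          exists_mem_dualCode_hammingNorm_le_four x (two_ne_zero_zmod hp2) h3
        exact ⟨⟨v, hv, hv0, le_antisymm hv4 (four_le_hammingNorm_of_mem_dualCode x hv hv0)⟩,
          fun c hc hc0 => four_le_hammingNorm_of_mem_dualCode x hc hc0⟩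
    refine ⟨hcode, ⟨hcode, ?_⟩, fun d hd => not_spherePackingBound hp5 hd⟩
    rintro ⟨C', hC'⟩
    have h := hC'.card_weight_two_mul_le
    rw [ZMod.card] at h
    exact absurd h (not_le.2 (sphere_packing_fails hp5))
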